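/- Let $\mathrm{SU}(2)$ act naturally on $\mathbb{CP}^1$, and let $\omega_{\rm FS}$ be the Fubini–Study form, equal to $\frac{dx\wedge dy}{(1+x^2+y^2)^2}$ in each of the two affine coordinates $x+iy=z_2/z_1$ and $x+iy=z_1/z_2$. Let $e_1=\begin{pmatrix}0&1\\-1&0\end{pmatrix}$, $e_2=\begin{pmatrix}0&i\\i&0\end{pmatrix}$, $e_3=\begin{pmatrix}i&0\\0&-i\end{pmatrix}$ be the basis of $\mathfrak g=\mathfrak{su}(2)$, with dual basis $\varepsilon^i$, coordinates $\xi_i=\langle\xi,e_i\rangle$ on $\mathfrak g^*$ and structure constants $[e_i,e_j]=c_{ij}^k e_k$. Write $X_M(p)=\frac{d}{ds}\big|_{0}\exp(-sX)\cdot p$ for the fundamental vector fields, and use $X\wedge Y=X\otimes Y-Y\otimes X$. A twist $t=\frac12\sum_{i,j} t^{ij}e_i\wedge e_j\in\Lambda^2\mathfrak g$ ($t^{ij}=-t^{ji}$) has fundamental bivector field $t_M=\frac12\sum_{i,j} t^{ij}(e_i)_M\wedge(e_j)_M$. The twisted complement $\mathfrak g^*_t=\mathrm{span}\{\varepsilon^i+\sum_j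 t^{ij}e_j\}\subset\mathfrak g\oplus\mathfrak g^*$ is called admissible at $\xi\in\mathfrak g^*$ if the infinitesimal dressing action of $T^*\mathrm{SU}(2)=\mathfrak g^*\rtimes \mathrm{SU}(2)$ on $T^*\mathrm{SU}(2)/\mathrm{SU}(2)\cong\mathfrak g^*$ (induced by $(\eta,g)\cdot\xi=\eta+\mathrm{Ad}^*_g\xi$) maps $\mathfrak g^*_t$ isomorphically onto $T_\xi\mathfrak g^*$. Its admissibility matrix is $A_t(\xi)_{il}=\delta_{il}+\sum_{j,k}t^{ij}c_{lj}^k\xi_k$. We say that $t$ deforms a symplectic form $\omega$, with induced nondegenerate Poisson structure $\pi$ (normalised by $\pi(\omega(u,\cdot),\omega(v,\cdot))=\omega(u,v)$), to a symplectic form $\omega^t$ if $\pi-t_M$ is a nondegenerate Poisson structure and is induced by $\omega^t$. Then $\omega_{\rm FS}$ is a well-defined symplectic form, and $$\langle\mu([z]),X\rangle=-\tfrac12\,\mathrm{Im}\frac{\langle z,Xz\rangle}{\langle z,z\rangle}$$ ($\langle\cdot,\cdot\rangle$ linear in the first argument) is a smooth equivariant map $\mu:\mathbb{CP}^1\to\mathfrak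 g^*$ with $d\langle\mu,X\rangle=\omega_{\rm FS}(X_M,\cdot)$, whose image is the sphere $\xi_1^2+\xi_2^2+\xi_3^2=\frac14$. Let $\lambda_{12},\lambda_{13},\lambda_{23}\in\mathbb R$. (1) For the twist $T$ with components $t^{ij}=\lambda_{ij}$ ($i<j$) and every $\xi\in\mathfrak g^*$, $$\det A_T(\xi)=(1+2\lambda_{23}\xi_1-2\lambda_{13}\xi_2+2\lambda_{12}\xi_3)^2,$$ and $\mathfrak g^*_T$ is admissible at $\xi$ if and only if $1+2\lambda_{23}\xi_1-2\lambda_{13}\xi_2+2\lambda_{12}\xi_3\ne0$. (2) $\mathfrak g^*_T$ is admissible at every point of $\mu(\mathbb{CP}^1)$ if and only if $\lambda_{12}^2+\lambda_{13}^2+\lambda_{23}^2<1$. (3) If $\lambda_{12}^2+\lambda_{13}^2+\lambda_{23}^2<1$, then the plane $1+2\lambda_{23}\xi_1-2\lambda_{13}\xi_2+2\lambda_{12}\xi_3=0$ does not meet $\mu(\mathbb{CP}^1)$. Moreover, both for $t=T$ and for $t=\sum_{i<j}\frac12\lambda_{ij}e_i\wedge e_j=\frac12T$, the complement $\mathfrak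 g^*_t$ is admissible at every point of $\mu(\mathbb{CP}^1)$ and $t$ deforms $\omega_{\rm FS}$ to a symplectic form $\omega_{\rm FS}^t$, which is unique. -/

import Mathlib

open scoped Manifold ContDiff Matrix LinearAlgebra.Projectivization

noncomputable section

namespace TwistDeformation

/-! ## Two-forms and bivector fields on a manifold without boundary

`M` is a manifold modelled on a finite-dimensional real normed space `E`. -/

section Manifold

variable {E : Type*} [NormedAddCommGroup E] [NormedSpace ℝ E]
  {M : Type*} [TopologicalSpace M] [ChartedSpace E M]

/-- The tangent space `T_p M`. -/
abbrev TSpace (E : Type*) [NormedAddCommGroup E] [NormedSpace ℝ E]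
    {M : Type*} [TopologicalSpace M] [ChartedSpace E M] (p : M) : Type _ :=
  TangentSpace 𝓘(ℝ, E) p

/-- A (not necessarily smooth) differential two-form on `M`. -/
abbrev TwoForm (E : Type*) [NormedAddCommGroup E] [NormedSpace ℝ E]
    (M : Type*) [TopologicalSpace M] [ChartedSpace E M] : Type _ :=
  ∀ p : M, TSpace E p [⋀^Fin 2]→L[ℝ] ℝ

/-- The expression of a two-form in a chart `e`: its pull-back by `e⁻¹`. -/
def TwoForm.inChart (Ω : TwoForm E M) (e : OpenPartialHomeomorph M E) :
    E → E [⋀^Fin 2]→L[ℝ] ℝ := fun y =>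
  (Ω (e.symm y)).compContinuousLinearMap (mfderiv 𝓘(ℝ, E) 𝓘(ℝ, E) e.symm y)

/-- A symplectic form: a smooth, closed, nondegenerate two-form. -/
structure IsSymplectic (Ω : TwoForm E M) : Prop where
  smooth : ∀ e ∈ atlas E M, ContDiffOn ℝ ∞ (Ω.inChart e) e.target
  closed : ∀ e ∈ atlas E M, ∀ y ∈ e.target, extDeriv (Ω.inChart e) y = 0
  nondegenerate : ∀ (p : M) (u : TSpace E p), (∀ v : TSpace E p, Ω p ![u, v] = 0) → u = 0

/-- The covector `Ω(u, ·)` at `p`. -/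
def TwoForm.flat (Ω : TwoForm E M) (p : M) (u : TSpace E p) : Module.Dual ℝ (TSpace E p) where
  toFun v := Ω p ![u, v]
  map_add' v w := by
    have h := (Ω p).toMultilinearMap.map_update_add ![u, 0] 1 v w
    have e : ∀ x : TSpace E p, Function.update ![u, 0] 1 x = ![u, x] := fun x => by
      ext i; fin_cases i <;> rfl
    rw [e, e, e] at h
    exact h
  map_smul' c v := by
    have h := (Ω p).toMultilinearMap.map_update_smul ![u, 0] 1 c v
    have e : ∀ x : TSpace E p, Function.update ![u, 0] 1 x = ![u, x] := fun x => by
      ext i; fin_cases i <;> rfl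
    rw [e, e] at h
    exact h

/-- A (not necessarily smooth or alternating) field of bilinear forms on the cotangent spaces. -/
abbrev BiField (E : Type*) [NormedAddCommGroup E] [NormedSpace ℝ E]
    (M : Type*) [TopologicalSpace M] [ChartedSpace E M] : Type _ :=
  ∀ p : M, LinearMap.BilinForm ℝ (Module.Dual ℝ (TSpace E p))

/-- The components of `π` in a chart `e`: the value at `e⁻¹ y` on the pull-backs
by `e` of the constant covectors `α` and `β`. -/
def BiField.inChart (π : BiField E M) (e : OpenPartialHomeomorph M E)
    (α β : Module.Dual ℝ E) (y : E) : ℝ :=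
  π (e.symm y)
    (α ∘ₗ (mfderiv 𝓘(ℝ, E) 𝓘(ℝ, E) e (e.symm y)).toLinearMap)
    (β ∘ₗ (mfderiv 𝓘(ℝ, E) 𝓘(ℝ, E) e (e.symm y)).toLinearMap)

/-- One half of the Schouten bracket `[π, π]`, in the chart `e`, on constant covectors:
the cyclic sum of `π^{il} ∂_l π^{jk}`. -/
def BiField.halfSchouten (π : BiField E M) (e : OpenPartialHomeomorph M E)
    (α β γ : Module.Dual ℝ E) (y : E) : ℝ :=
  π.inChart e α (fderiv ℝ (π.inChart e β γ) y).toLinearMap y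
    + π.inChart e β (fderiv ℝ (π.inChart e γ α) y).toLinearMap y
    + π.inChart e γ (fderiv ℝ (π.inChart e α β) y).toLinearMap y

/-- A nondegenerate Poisson structure: a smooth bivector field `π` with `[π, π] = 0`, such that
no nonzero covector `α` satisfies `π(α, ·) = 0`. -/
structure IsNondegeneratePoisson (π : BiField E M) : Prop where
  alternating : ∀ (p : M) (α : Module.Dual ℝ (TSpace E p)), π p α α = 0
  smooth : ∀ e ∈ atlas E M, ∀ α β : Module.Dual ℝ E, ContDiffOn ℝ ∞ (π.inChart e α β) e.target
  schouten : ∀ e ∈ atlas E M, ∀ α β γ : Module.Dual ℝ E, ∀ y ∈ e.target,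
    π.halfSchouten e α β γ y = 0
  nondegenerate : ∀ (p : M) (α : Module.Dual ℝ (TSpace E p)), (∀ β, π p α β = 0) → α = 0

/-- The nondegenerate two-form `Ω` and the bivector field `π` induce each other:
`π(Ω(u, ·), Ω(v, ·)) = Ω(u, v)`. -/
def Corresponds (Ω : TwoForm E M) (π : BiField E M) : Prop :=
  ∀ (p : M) (u v : TSpace E p), π p (Ω.flat p u) (Ω.flat p v) = Ω p ![u, v]

end Manifold

/-! ## The complex projective line -/

/-- The complex projective line. -/
abbrev CP1 : Type := ℙ ℂ (Fin 2 → ℂ)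

/-- The quotient topology from `ℂ² ∖ {0}`. -/
instance : TopologicalSpace CP1 :=
  TopologicalSpace.coinduced (Projectivization.mk' ℂ) inferInstance

theorem isQuotientMap_mk' :
    Topology.IsQuotientMap (Projectivization.mk' ℂ : {v : Fin 2 → ℂ // v ≠ 0} → CP1) where
  surjective p := ⟨⟨p.rep, p.rep_nonzero⟩, p.mk_rep⟩
  isCoinducing := ⟨rfl⟩

/-- The affine coordinate `[z] ↦ z_j / z_i`, where `j` is the index other than `i`. -/
def affineCoord (i : Fin 2) : CP1 → ℂ :=
  Projectivization.lift (fun z => z.1 (i + 1) / z.1 i) (by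
    rintro ⟨a, ha⟩ ⟨b, hb⟩ t (rfl : a = t • b)
    have ht : t ≠ 0 := by rintro rfl; simp at ha
    simp [mul_div_mul_left _ _ ht])

/-- The open set `z_i ≠ 0`. -/
def affineDomain (i : Fin 2) : Set CP1 :=
  {p | ∃ z : {v : Fin 2 → ℂ // v ≠ 0}, Projectivization.mk' ℂ z = p ∧ z.1 i ≠ 0}

/-- The vector whose `i`-th entry is `1` and whose other entry is `w`. -/
def affineVec (i : Fin 2) (w : ℂ) : Fin 2 → ℂ := Function.update (fun _ => w) i 1

theorem affineVec_self (i : Fin 2) (w : ℂ) : affineVec i w i = 1 := by simp [affineVec]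

theorem affineVec_other (i : Fin 2) (w : ℂ) : affineVec i w (i + 1) = w := by
  fin_cases i <;> simp [affineVec]

theorem affineVec_ne_zero (i : Fin 2) (w : ℂ) : affineVec i w ≠ 0 := fun h => by
  simpa [affineVec_self] using congrFun h i

theorem mk_mem_affineDomain (i : Fin 2) (z : {v : Fin 2 → ℂ // v ≠ 0}) :
    (Projectivization.mk' ℂ z : CP1) ∈ affineDomain i ↔ z.1 i ≠ 0 := by
  constructor
  · rintro ⟨w, hw, hi⟩ h0
    obtain ⟨a, ha⟩ := (Projectivization.mk_eq_mk_iff' ℂ _ _ w.2 z.2).1 hw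
    apply hi
    rw [← ha]
    simp [h0]
  · intro h
    exact ⟨z, rfl, h⟩

theorem isOpen_affineDomain (i : Fin 2) : IsOpen (affineDomain i) := by
  rw [← isQuotientMap_mk'.isOpen_preimage]
  have : (Projectivization.mk' ℂ : {v : Fin 2 → ℂ // v ≠ 0} → CP1) ⁻¹' affineDomain i
      = {z | z.1 i ≠ 0} := by
    ext z
    exact mk_mem_affineDomain i z
  rw [this]
  exact isOpen_ne_fun ((continuous_apply i).comp continuous_subtype_val) continuous_const

theorem continuous_affineVec (i : Fin 2) : Continuous (affineVec i) :=
  (continuous_pi fun _ => continuous_id).update i continuous_const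

/-- The affine chart `[z] ↦ z_j / z_i` on the open set `z_i ≠ 0`, with values in `ℂ = ℝ²`. -/
def affineChart (i : Fin 2) : OpenPartialHomeomorph CP1 ℂ where
  toFun := affineCoord i
  invFun w := Projectivization.mk ℂ (affineVec i w) (affineVec_ne_zero i w)
  source := affineDomain i
  target := Set.univ
  map_source' _ _ := Set.mem_univ _
  map_target' w _ := ⟨⟨_, affineVec_ne_zero i w⟩, rfl, by simp [affineVec_self]⟩
  left_inv' := by
    rintro _ ⟨z, rfl, hz⟩
    refine (Projectivization.mk_eq_mk_iff' ℂ _ _ _ z.2).2 ⟨(z.1 i)⁻¹, ?_⟩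
    obtain ⟨z, hz0⟩ := z
    simp only at hz
    ext k
    fin_cases i <;> fin_cases k <;>
      simp_all [affineVec, affineCoord, div_eq_inv_mul]
  right_inv' w _ := by
    simp [affineCoord, affineVec_self, affineVec_other]
  open_source := isOpen_affineDomain i
  open_target := isOpen_univ
  continuousOn_toFun := by
    rw [isQuotientMap_mk'.continuousOn_isOpen_iff (isOpen_affineDomain i)]
    have : ContinuousOn (fun z : {v : Fin 2 → ℂ // v ≠ 0} => z.1 (i + 1) / z.1 i)
        {z | z.1 i ≠ 0} :=
      ContinuousOn.div ((continuous_apply (i + 1)).comp continuous_subtype_val).continuousOn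
        ((continuous_apply i).comp continuous_subtype_val).continuousOn (fun z hz => hz)
    refine this.mono fun z hz => ?_
    exact (mk_mem_affineDomain i z).1 hz
  continuousOn_invFun := by
    apply Continuous.continuousOn
    exact isQuotientMap_mk'.continuous.comp
      ((continuous_affineVec i).subtype_mk (affineVec_ne_zero i))

theorem exists_mem_affineDomain (p : CP1) : ∃ i, p ∈ affineDomain i := by
  obtain ⟨z, rfl⟩ := isQuotientMap_mk'.surjective p
  obtain ⟨i, hi⟩ := Function.ne_iff.1 z.2
  exact ⟨i, z, rfl, hi⟩

/-- The smooth structure on the complex projective line, given by the two affine charts. -/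
instance : ChartedSpace ℂ CP1 where
  atlas := Set.range affineChart
  chartAt p := affineChart (exists_mem_affineDomain p).choose
  mem_chart_source p := (exists_mem_affineDomain p).choose_spec
  chart_mem_atlas _ := ⟨_, rfl⟩

theorem affineChart_transition (i : Fin 2) (w : ℂ) :
    affineCoord (i + 1) ((affineChart i).symm w) = w⁻¹ := by
  have h : i + 1 + 1 = i := by fin_cases i <;> rfl
  change affineVec i w (i + 1 + 1) / affineVec i w (i + 1) = w⁻¹
  rw [h, affineVec_self, affineVec_other, one_div]

instance : IsManifold 𝓘(ℝ, ℂ) ∞ CP1 := by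
  apply isManifold_of_contDiffOn
  rintro _ _ ⟨i, rfl⟩ ⟨j, rfl⟩
  simp only [modelWithCornersSelf_coe, modelWithCornersSelf_coe_symm, Function.comp_def, id]
  by_cases hij : j = i
  · subst hij
    refine contDiffOn_id.congr fun w _ => ?_
    exact (affineChart j).right_inv (Set.mem_univ w)
  · have hj : j = i + 1 := by fin_cases i <;> fin_cases j <;> simp_all
    subst hj
    have : ContDiffOn ℝ ∞ (fun w : ℂ => w⁻¹) {w | w ≠ 0} := fun w hw =>
      (contDiffAt_inv ℝ hw).contDiffWithinAt
    refine (this.mono ?_).congr fun w _ => affineChart_transition i w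
    intro w hw
    have h1 : (affineChart i).symm w ∈ affineDomain (i + 1) := by
      have hw' : w ∈ (affineChart i).target ∧
          (affineChart i).symm w ∈ (affineChart (i + 1)).source := by simpa using hw
      exact hw'.2
    have h2 := (mk_mem_affineDomain (i + 1) ⟨_, affineVec_ne_zero i w⟩).1 h1
    simpa [affineVec_other] using h2

/-- The area form `dx ∧ dy` on `ℂ = ℝ²`. -/
def area : ℂ [⋀^Fin 2]→L[ℝ] ℝ :=
  { Complex.basisOneI.det with
    cont := by
      change Continuous fun v : Fin 2 → ℂ => Complex.basisOneI.det v
      simp only [Module.Basis.det_apply, Matrix.det_fin_two, Module.Basis.toMatrix_apply,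
        Complex.coe_basisOneI_repr]
      simp only [Matrix.cons_val_zero, Matrix.cons_val_one]
      fun_prop }

theorem area_apply (v : Fin 2 → ℂ) : area v = (v 0).re * (v 1).im - (v 1).re * (v 0).im := by
  change Complex.basisOneI.det v = _
  simp [Module.Basis.det_apply, Matrix.det_fin_two, Module.Basis.toMatrix_apply]

/-- The two-form `dx ∧ dy / (x² + y² + 1)²` on `ℂ = ℝ²`. -/
def fubiniStudyModel (w : ℂ) : ℂ [⋀^Fin 2]→L[ℝ] ℝ := ((w.re ^ 2 + w.im ^ 2 + 1) ^ 2)⁻¹ • area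

/-- The pull-back at `p` of `dx ∧ dy / (x² + y² + 1)²` by the `i`-th affine chart. -/
def fubiniStudyOn (i : Fin 2) (p : CP1) : TSpace ℂ p [⋀^Fin 2]→L[ℝ] ℝ :=
  (fubiniStudyModel (affineChart i p)).compContinuousLinearMap
    (mfderiv 𝓘(ℝ, ℂ) 𝓘(ℝ, ℂ) (affineChart i) p)

/-- The Fubini–Study form: at `p` it is the pull-back of `dx ∧ dy / (x² + y² + 1)²` by an affine
chart around `p` (the pull-backs by the two charts agree where both are defined). -/
def fubiniStudy : TwoForm ℂ CP1 := fun p => fubiniStudyOn (exists_mem_affineDomain p).choose p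

/-! ## The group `SU(2)` and its Lie algebra -/

attribute [local instance] LieRing.ofAssociativeRing

/-- The group `SU(2)`. -/
abbrev SU2 : Type := Matrix.specialUnitaryGroup (Fin 2) ℂ

/-- The Lie algebra `su(2)` of traceless skew-Hermitian matrices. -/
def su2 : LieSubalgebra ℝ (Matrix (Fin 2) (Fin 2) ℂ) where
  carrier := {X | Xᴴ = -X ∧ X.trace = 0}
  zero_mem' := by simp
  add_mem' := by
    rintro X Y ⟨hX, hX'⟩ ⟨hY, hY'⟩
    exact ⟨by rw [Matrix.conjTranspose_add, hX, hY, neg_add], by rw [Matrix.trace_add, hX', hY',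
      add_zero]⟩
  smul_mem' := by
    rintro c X ⟨hX, hX'⟩
    exact ⟨by rw [Matrix.conjTranspose_smul, hX, star_trivial, smul_neg], by
      rw [Matrix.trace_smul, hX', smul_zero]⟩
  lie_mem' := by
    rintro X Y ⟨hX, -⟩ ⟨hY, -⟩
    refine ⟨?_, ?_⟩
    · rw [Ring.lie_def, Matrix.conjTranspose_sub, Matrix.conjTranspose_mul,
        Matrix.conjTranspose_mul, hX, hY]
      noncomm_ring
    · rw [Ring.lie_def, Matrix.trace_sub, Matrix.trace_mul_comm, sub_self]

/-- The matrix with coordinates `c` in the basis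
`e₁ = [0, 1; -1, 0]`, `e₂ = [0, i; i, 0]`, `e₃ = [i, 0; 0, -i]`. -/
def su2Mat (c : Fin 3 → ℝ) : Matrix (Fin 2) (Fin 2) ℂ :=
  !![c 2 * Complex.I, c 0 + c 1 * Complex.I; -c 0 + c 1 * Complex.I, -(c 2 * Complex.I)]

theorem su2Mat_mem (c : Fin 3 → ℝ) : su2Mat c ∈ su2 := by
  refine ⟨?_, ?_⟩
  · ext i j
    fin_cases i <;> fin_cases j <;> simp [su2Mat, Complex.ext_iff]
  · simp [su2Mat, Matrix.trace_fin_two]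

/-- The basis `e₁ = [0, 1; -1, 0]`, `e₂ = [0, i; i, 0]`, `e₃ = [i, 0; 0, -i]` of `su(2)`
(indexed by `0, 1, 2`). -/
def su2Basis : Module.Basis (Fin 3) ℝ su2 :=
  Module.Basis.ofEquivFun
    { toFun := fun X => ![(X.1 0 1).re, (X.1 0 1).im, (X.1 0 0).im]
      invFun := fun c => ⟨su2Mat c, su2Mat_mem c⟩
      map_add' := fun X Y => by ext i; fin_cases i <;> simp
      map_smul' := fun c X => by ext i; fin_cases i <;> simp
      left_inv := by
        rintro ⟨X, hX, hX'⟩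
        have h00 := congrFun (congrFun hX 0) 0
        have h01 := congrFun (congrFun hX 1) 0
        rw [Matrix.trace_fin_two] at hX'
        simp [Complex.ext_iff] at h00 h01 hX'
        apply Subtype.ext
        ext i j
        fin_cases i <;> fin_cases j <;> simp [su2Mat, Complex.ext_iff] <;> grind
      right_inv := fun c => by
        ext i
        fin_cases i <;> simp [su2Mat] }

theorem su2Basis_apply (i : Fin 3) :
    (su2Basis i : Matrix (Fin 2) (Fin 2) ℂ)
      = ![!![0, 1; -1, 0], !![0, Complex.I; Complex.I, 0],
          !![Complex.I, 0; 0, -Complex.I]] i := by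
  have h : (su2Basis i : Matrix (Fin 2) (Fin 2) ℂ) = su2Mat (Pi.single i 1) := by
    rw [su2Basis, Module.Basis.coe_ofEquivFun]
    rfl
  rw [h]
  fin_cases i <;> ext a b <;> fin_cases a <;> fin_cases b <;> simp [su2Mat]

/-- The dual `su(2)*`. -/
abbrev su2Dual : Type := Module.Dual ℝ su2

theorem det_exp_of_trace_eq_zero (X : Matrix (Fin 2) (Fin 2) ℂ) (hX : X.trace = 0) :
    (NormedSpace.exp X).det = 1 := by
  have sq : ∀ Y : Matrix (Fin 2) (Fin 2) ℂ, Y.trace = 0 → (NormedSpace.exp Y).det ^ 2 = 1 := by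
    intro Y hY
    let J : Matrix (Fin 2) (Fin 2) ℂ := !![0, 1; -1, 0]
    let U : (Matrix (Fin 2) (Fin 2) ℂ)ˣ := ⟨J, -J, by
      ext a b; fin_cases a <;> fin_cases b <;> simp [J], by
      ext a b; fin_cases a <;> fin_cases b <;> simp [J]⟩
    have h1 : (U : Matrix (Fin 2) (Fin 2) ℂ) * Yᵀ * (U⁻¹ : (Matrix (Fin 2) (Fin 2) ℂ)ˣ) = -Y := by
      rw [Matrix.trace_fin_two] at hY
      have hY' : Y 1 1 = - Y 0 0 := by linear_combination hY
      change J * Yᵀ * (-J) = -Y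
      ext a b
      fin_cases a <;> fin_cases b <;> simp [J, Matrix.mul_apply, Matrix.vecMul, dotProduct, Fin.sum_univ_two, hY']
    have h2 := Matrix.exp_units_conj U Yᵀ
    rw [h1, Matrix.exp_transpose] at h2
    have h3 := congrArg Matrix.det h2
    rw [Matrix.det_units_conj, Matrix.det_transpose] at h3
    have h4 : NormedSpace.exp Y * NormedSpace.exp (-Y) = 1 := by
      rw [← Matrix.exp_add_of_commute _ _ (Commute.neg_right (Commute.refl Y)), add_neg_cancel,
        NormedSpace.exp_zero]
    have h5 := congrArg Matrix.det h4
    rw [Matrix.det_mul, h3, Matrix.det_one] at h5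
    rw [sq, h5]
  have hhalf := sq ((1 / 2 : ℂ) • X) (by simp [Matrix.trace_smul, hX])
  have hX2 : X = (1 / 2 : ℂ) • X + (1 / 2 : ℂ) • X := by
    rw [← add_smul]
    norm_num
  rw [hX2, Matrix.exp_add_of_commute _ _ (Commute.refl _), Matrix.det_mul, ← pow_two, hhalf]

/-- The exponential map `su(2) → SU(2)`. -/
def expSU2 (X : su2) : SU2 :=
  ⟨NormedSpace.exp X.1, by
    rw [Matrix.mem_specialUnitaryGroup_iff]
    refine ⟨?_, det_exp_of_trace_eq_zero _ X.2.2⟩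
    rw [Matrix.mem_unitaryGroup_iff, Matrix.star_eq_conjTranspose, ← Matrix.exp_conjTranspose,
      X.2.1, ← Matrix.exp_add_of_commute _ _ (Commute.neg_right (Commute.refl X.1)),
      add_neg_cancel, NormedSpace.exp_zero]⟩

/-- The inclusion `SU(2) → SL(2, ℂ)`. -/
def toSL : SU2 →* Matrix.SpecialLinearGroup (Fin 2) ℂ where
  toFun g := ⟨g.1, (Matrix.mem_specialUnitaryGroup_iff.1 g.2).2⟩
  map_one' := rfl
  map_mul' _ _ := rfl

/-- The natural action of `SU(2)` on the complex projective line. -/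
instance : MulAction SU2 CP1 := MulAction.compHom CP1 toSL

theorem smul_mk (g : SU2) (z : Fin 2 → ℂ) (hz : z ≠ 0) :
    ∃ h : g.1 *ᵥ z ≠ 0, g • (Projectivization.mk ℂ z hz : CP1)
      = Projectivization.mk ℂ (g.1 *ᵥ z) h :=
  ⟨_, rfl⟩

/-- The fundamental vector field `X_M(p) = d/ds|₀ exp(-sX) · p` of `X` in `su(2)`. -/
def fundamentalField (X : su2) (p : CP1) : TSpace ℂ p :=
  mfderiv 𝓘(ℝ, ℝ) 𝓘(ℝ, ℂ) (fun s : ℝ => expSU2 (-(s • X)) • p) 0 (1 : ℝ)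

/-- The adjoint action `Ad_g X = g X g⁻¹`. -/
def Ad (g : SU2) : su2 →ₗ[ℝ] su2 where
  toFun X := ⟨g.1 * X.1 * (g⁻¹).1, by
    have h1 : (g⁻¹).1 = (g.1)ᴴ := rfl
    refine ⟨?_, ?_⟩
    · rw [h1, Matrix.conjTranspose_mul, Matrix.conjTranspose_mul, X.2.1,
        Matrix.conjTranspose_conjTranspose]
      noncomm_ring
    · rw [Matrix.trace_mul_cycle, ← Submonoid.coe_mul, inv_mul_cancel]
      simpa using X.2.2⟩
  map_add' X Y := Subtype.ext (by simp [mul_add, add_mul])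
  map_smul' c X := Subtype.ext (by simp)

theorem Ad_one (X : su2) : Ad 1 X = X := Subtype.ext (by simp [Ad])

theorem Ad_mul (g h : SU2) (X : su2) : Ad (g * h) X = Ad g (Ad h X) :=
  Subtype.ext (by simp [Ad, mul_assoc])

/-- The coadjoint action `⟨Ad*_g ξ, X⟩ = ⟨ξ, Ad_{g⁻¹} X⟩`, as an action by group automorphisms of
the additive group `su(2)*`. -/
def coAd : SU2 →* MulAut (Multiplicative su2Dual) where
  toFun g := AddEquiv.toMultiplicative
    { toFun := fun ξ => ξ ∘ₗ Ad g⁻¹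
      invFun := fun ξ => ξ ∘ₗ Ad g
      left_inv := fun ξ => by ext X; simp [← Ad_mul, Ad_one]
      right_inv := fun ξ => by ext X; simp [← Ad_mul, Ad_one]
      map_add' := fun ξ η => LinearMap.add_comp _ _ _ }
  map_one' := by
    refine MulEquiv.ext fun ξ => Multiplicative.toAdd.injective (LinearMap.ext fun X => ?_)
    simp [Ad_one]
  map_mul' g h := by
    refine MulEquiv.ext fun ξ => Multiplicative.toAdd.injective (LinearMap.ext fun X => ?_)
    simp [Ad_mul]

/-- The moment map `⟨μ([z]), X⟩ = -½ Im (⟨z, X z⟩ / ⟨z, z⟩)`, where the Hermitian product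
`⟨u, v⟩ = ∑ u_k conj(v_k)` is linear in the first argument. -/
def momentMap : CP1 → su2Dual :=
  Projectivization.lift (fun z =>
    { toFun := fun X => -(1 / 2) * ((z.1 ⬝ᵥ star (X.1 *ᵥ z.1)) / (z.1 ⬝ᵥ star z.1)).im
      map_add' := fun X Y => by
        rw [Submodule.coe_add, Matrix.add_mulVec, star_add, dotProduct_add, add_div,
          Complex.add_im, mul_add]
      map_smul' := fun c X => by
        have h : ((c • X : su2) : Matrix (Fin 2) (Fin 2) ℂ) = (c : ℂ) • X.1 := by
          ext i j
          simp
        rw [h, Matrix.smul_mulVec, star_smul, dotProduct_smul, smul_eq_mul, mul_div_assoc]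
        simp
        ring }) (by
    rintro ⟨a, ha⟩ ⟨b, hb⟩ t (rfl : a = t • b)
    have ht : t ≠ 0 := by rintro rfl; simp at ha
    have ht' : star t ≠ 0 := by simpa using ht
    ext X
    simp only [Matrix.mulVec_smul, star_smul, dotProduct_smul, smul_dotProduct, smul_eq_mul,
      LinearMap.coe_mk, AddHom.coe_mk]
    rw [← mul_assoc, ← mul_assoc, mul_div_mul_left _ _ (mul_ne_zero ht' ht)])

/-- `μ` is a moment map for the action of `SU(2)` on the complex projective line with the
two-form `Ω`: it is smooth, equivariant, and `d⟨μ, X⟩ = Ω(X_M, ·)`. -/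
structure IsMomentMap (Ω : TwoForm ℂ CP1) (μ : CP1 → su2Dual) : Prop where
  smooth : ∀ X : su2, ContMDiff 𝓘(ℝ, ℂ) 𝓘(ℝ, ℝ) ∞ (fun p => μ p X)
  equivariant : ∀ (g : SU2) (p : CP1), μ (g • p) = (coAd g (.ofAdd (μ p))).toAdd
  differential : ∀ (X : su2) (p : CP1) (v : TSpace ℂ p),
    mfderiv 𝓘(ℝ, ℂ) 𝓘(ℝ, ℝ) (fun q => μ q X) p v = Ω p ![fundamentalField X p, v]

/-! ## Twists -/

/-- Twists, i.e. elements `t` of `Λ² su(2)`, regarded as antisymmetric maps `su(2)* → su(2)`. -/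
def twists : Submodule ℝ (su2Dual →ₗ[ℝ] su2) where
  carrier := {t : su2Dual →ₗ[ℝ] su2 | ∀ ξ : su2Dual, ξ (t ξ) = 0}
  zero_mem' := fun ξ => map_zero ξ
  add_mem' := by
    intro s t hs ht ξ
    rw [LinearMap.add_apply, map_add, hs, ht, add_zero]
  smul_mem' := by
    intro c t ht ξ
    rw [LinearMap.smul_apply, map_smul, ht, smul_zero]

/-- The space of twists. -/
abbrev Twist : Type := twists

/-- `X ∧ Y = X ⊗ Y - Y ⊗ X`, i.e. `ξ ↦ ξ(X) Y - ξ(Y) X`. -/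
def wedge (X Y : su2) : Twist :=
  ⟨(Module.Dual.eval ℝ su2 X).smulRight Y - (Module.Dual.eval ℝ su2 Y).smulRight X, fun ξ => by
    simp [mul_comm]⟩

/-- The component `t^{ij}` of a twist, so that `t = ½ ∑ t^{ij} e_i ∧ e_j` and
`t(ε^i) = ∑_j t^{ij} e_j`. -/
def Twist.component (t : Twist) (i j : Fin 3) : ℝ := su2Basis.coord j (t.1 (su2Basis.coord i))

/-- The fundamental bivector field `t_M = ½ ∑ t^{ij} (e_i)_M ∧ (e_j)_M`, i.e.
`t_M(α, β) = ∑ t^{ij} α((e_i)_M) β((e_j)_M)`. -/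
def Twist.fundamentalBivector (t : Twist) : BiField ℂ CP1 := fun p =>
  ∑ i, ∑ j, t.component i j • LinearMap.BilinForm.linMulLin
    (Module.Dual.eval ℝ (TSpace ℂ p) (fundamentalField (su2Basis i) p))
    (Module.Dual.eval ℝ (TSpace ℂ p) (fundamentalField (su2Basis j) p))

/-- The twist `t` deforms the symplectic form `Ω` to the symplectic form `Ω'`: if `π` is the
bivector field induced by `Ω`, then `π - t_M` is a nondegenerate Poisson structure, and it is
induced by `Ω'`. -/
def Deforms (t : Twist) (Ω Ω' : TwoForm ℂ CP1) : Prop :=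
  IsSymplectic Ω ∧ IsSymplectic Ω' ∧
    ∃ π : BiField ℂ CP1, IsNondegeneratePoisson π ∧ Corresponds Ω π ∧
      IsNondegeneratePoisson (π - t.fundamentalBivector) ∧
      Corresponds Ω' (π - t.fundamentalBivector)

/-! ## The cotangent group, its dressing action, and admissibility -/

/-- The group `D = T*SU(2) = su(2)* ⋊ SU(2)`, with respect to the coadjoint action. -/
abbrev CotangentGroup : Type := Multiplicative su2Dual ⋊[coAd] SU2

/-- The dressing action of `D` on `D/SU(2) = su(2)*`: `(ξ, g) · η = ξ + Ad*_g η`. -/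
def dressing (d : CotangentGroup) (η : su2Dual) : su2Dual :=
  d.left.toAdd + (coAd d.right (.ofAdd η)).toAdd

/-- `D/SU(2)` is `su(2)*`, and the action by left multiplication is `dressing`. -/
theorem exists_quotient_equiv :
    ∃ e : CotangentGroup ⧸ (SemidirectProduct.inr : SU2 →* CotangentGroup).range ≃ su2Dual,
      (∀ ξ : su2Dual, e (SemidirectProduct.inl (.ofAdd ξ) : CotangentGroup) = ξ) ∧
      ∀ (d : CotangentGroup) x, e (d • x) = dressing d (e x) := by
  have key : ∀ a b : CotangentGroup,
      QuotientGroup.leftRel (SemidirectProduct.inr : SU2 →* CotangentGroup).range a b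
        ↔ a.left = b.left := by
    intro a b
    rw [QuotientGroup.leftRel_apply]
    constructor
    · rintro ⟨g, hg⟩
      have h : b = a * SemidirectProduct.inr g := by rw [hg]; group
      rw [h]
      simp
    · intro h
      refine ⟨a.right⁻¹ * b.right, ?_⟩
      ext1
      · simp [h]
      · simp
  refine ⟨⟨Quotient.lift (fun a : CotangentGroup => a.left.toAdd)
      (fun a b h => congrArg _ ((key a b).1 h)),
    fun ξ => ((SemidirectProduct.inl (.ofAdd ξ) : CotangentGroup) : _ ⧸ _), ?_, ?_⟩, ?_, ?_⟩
  · rintro ⟨a⟩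
    exact Quotient.sound ((key _ _).2 rfl)
  · intro ξ
    rfl
  · intro ξ
    rfl
  · rintro d ⟨a⟩
    rfl

/-- The Lie algebra `d = su(2) ⊕ su(2)*` of `D`, as a vector space. -/
abbrev Double : Type := su2 × su2Dual

/-- The curve `s ↦ (-sξ, exp(-sX))` in `D`, through `1` with velocity `-(X, ξ)` at `s = 0`. -/
def doubleCurve (x : Double) (s : ℝ) : CotangentGroup :=
  ⟨.ofAdd (-(s • x.2)), expSU2 (-(s • x.1))⟩

/-- `ζ` is the value at `η` of the infinitesimal dressing action of `x`, that is, the derivative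
at `s = 0` of `s ↦ doubleCurve x s · η` in the finite-dimensional space `su(2)*`. -/
def IsDressingVelocity (x : Double) (η ζ : su2Dual) : Prop :=
  ∀ Y : su2, HasDerivAt (fun s : ℝ => dressing (doubleCurve x s) η Y) (ζ Y) 0

/-- The twisted complement `{ξ + t(ξ)}`, spanned by the `ε^i + ∑_j t^{ij} e_j`. -/
def Twist.complement (t : Twist) : Submodule ℝ Double :=
  LinearMap.range (t.1.prod LinearMap.id)

/-- A subspace `h` of `d` is admissible at `η` if the infinitesimal dressing action restricts to a
bijection from `h` onto the tangent space `su(2)*` at `η`. -/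
def Admissible (h : Submodule ℝ Double) (η : su2Dual) : Prop :=
  ∃ f : h ≃ₗ[ℝ] su2Dual, ∀ x : h, IsDressingVelocity x.1 η (f x)

/-- The admissibility matrix `A_t(ξ)`, with entries `δ_{il} + ∑ t^{ij} c_{lj}^k ξ_k`, where
`[e_l, e_j] = ∑ c_{lj}^k e_k` and `ξ_k = ξ(e_k)`: minus the matrix of the infinitesimal
dressing action at `ξ` in the bases `ε^i + ∑_j t^{ij} e_j` and `∂/∂ξ_l`. -/
def Twist.admissibilityMatrix (t : Twist) (ξ : su2Dual) : Matrix (Fin 3) (Fin 3) ℝ :=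
  Matrix.of fun i l => (if i = l then 1 else 0)
    + ∑ j, ∑ k, t.component i j * su2Basis.coord k ⁅su2Basis l, su2Basis j⁆ * ξ (su2Basis k)

/-- The twist `a e₁ ∧ e₂ + b e₁ ∧ e₃ + c e₂ ∧ e₃`. -/
def twistOf (a b c : ℝ) : Twist :=
  a • wedge (su2Basis 0) (su2Basis 1) + b • wedge (su2Basis 0) (su2Basis 2)
    + c • wedge (su2Basis 1) (su2Basis 2)

end TwistDeformation

end

noncomputable section

namespace TwistDeformation

attribute [local instance] LieRing.ofAssociativeRing

/-! ## The exponential map and the infinitesimal dressing action -/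

section MatrixExp

attribute [local instance] Matrix.linftyOpNormedRing Matrix.linftyOpNormedAlgebra

/-! Everything is governed by the affine function `planeFun`, f(ξ) = 1 + 2⟨n, ξ⟩ with n = (λ₂₃,
-λ₁₃, λ₁₂).

Admissibility: the infinitesimal dressing action of (X, ξ) at η is -ξ + η ∘ ad_X. The twisted
complement is a graph over su(2)*, so admissibility says that an endomorphism of su(2)*, with matrix
minus the transpose of A_t(η), is invertible (`admissible_complement_iff`,
`velocity_injective_iff`). Its determinant is, up to sign, f(η)² (`det_admissibilityMatrix`). On the
sphere of radius 1/2, which is the image of μ (`range_momentMap`), the minimum of f is 1 - |n|, so f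
has a zero there exactly when |n| ≥ 1 (`planeFun_pos`, `exists_planeFun_eq_zero`).

Deformation: a real surface carries, pointwise, a single bivector up to scale, so t_M is a function
times π. Differentiating the equivariance of μ gives ω(X_M, Y_M) = ⟨μ, [Y, X]⟩, and a Plücker
relation in the tangent plane then yields π - T_M = (f ∘ μ) π
(`stdBivector_sub_fundamentalBivector`). In dimension two closedness and the Jacobi identity are
automatic, so where f ∘ μ never vanishes the deformed form is (f ∘ μ)⁻¹ ω, and nondegeneracy makes
it unique (`existsUnique_deforms`). -/

theorem hasDerivAt_matrix_exp_smul (X : Matrix (Fin 2) (Fin 2) ℂ) :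
    HasDerivAt (fun s : ℝ => NormedSpace.exp (s • X)) X 0 := by
  have h := hasDerivAt_exp_smul_const (𝕂 := ℝ) X 0
  rw [zero_smul, NormedSpace.exp_zero, one_mul] at h
  exact h

/-- Passing to entries removes the auxiliary matrix norm from the statement, so that it can be used
outside this section. -/
theorem hasDerivAt_exp_entry (X : Matrix (Fin 2) (Fin 2) ℂ) (a b : Fin 2) :
    HasDerivAt (fun s : ℝ => NormedSpace.exp (s • X) a b) (X a b) 0 := by
  have h := hasDerivAt_matrix_exp_smul X
  let l : Matrix (Fin 2) (Fin 2) ℂ →ₗ[ℝ] ℂ := Matrix.entryLinearMap ℝ ℂ a b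
  exact (LinearMap.toContinuousLinearMap l).hasFDerivAt.comp_hasDerivAt (0 : ℝ) h

theorem hasDerivAt_exp_conj (X Y : Matrix (Fin 2) (Fin 2) ℂ) (a b : Fin 2) :
    HasDerivAt (fun s : ℝ => (NormedSpace.exp (s • X) * Y * NormedSpace.exp (s • -X)) a b)
      (⁅X, Y⁆ a b) 0 := by
  have h := ((hasDerivAt_matrix_exp_smul X).mul_const Y).mul (hasDerivAt_matrix_exp_smul (-X))
  let l : Matrix (Fin 2) (Fin 2) ℂ →ₗ[ℝ] ℂ := Matrix.entryLinearMap ℝ ℂ a b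
  have h2 := (LinearMap.toContinuousLinearMap l).hasFDerivAt.comp_hasDerivAt (0 : ℝ) h
  refine h2.congr_deriv ?_
  change (X * Y * NormedSpace.exp ((0 : ℝ) • -X) + NormedSpace.exp ((0 : ℝ) • X) * Y * -X) a b = _
  simp [Ring.lie_def, sub_eq_add_neg]

end MatrixExp

theorem coe_expSU2_neg_smul (X : su2) (s : ℝ) :
    (expSU2 (-(s • X))).1 = NormedSpace.exp (s • (-X.1)) := by
  simp [expSU2]

theorem expSU2_neg_inv (X : su2) (s : ℝ) : (expSU2 (-(s • X)))⁻¹ = expSU2 (s • X) := by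
  apply Subtype.ext
  change (NormedSpace.exp (-(s • X) : su2).1)ᴴ = NormedSpace.exp (s • X : su2).1
  rw [← Matrix.exp_conjTranspose, (-(s • X) : su2).2.1]
  simp

theorem coe_Ad_expSU2 (X Y : su2) (s : ℝ) :
    (Ad (expSU2 (-(s • X)))⁻¹ Y).1
      = NormedSpace.exp (s • X.1) * Y.1 * NormedSpace.exp (s • -X.1) := by
  change ((expSU2 (-(s • X)))⁻¹).1 * Y.1 * ((expSU2 (-(s • X)))⁻¹⁻¹).1 = _
  rw [inv_inv, expSU2_neg_inv, coe_expSU2_neg_smul]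
  rfl

theorem su2Basis_coord (i : Fin 3) (X : su2) :
    su2Basis.coord i X = ![(X.1 0 1).re, (X.1 0 1).im, (X.1 0 0).im] i := rfl

theorem dual_eq_sum (η : su2Dual) (X : su2) :
    η X = (X.1 0 1).re * η (su2Basis 0) + (X.1 0 1).im * η (su2Basis 1)
      + (X.1 0 0).im * η (su2Basis 2) := by
  conv_lhs => rw [← su2Basis.sum_repr X]
  simp only [map_add, map_smul, Fin.sum_univ_three, smul_eq_mul]
  rfl

/-- The inverse in the coadjoint action cancels the sign in exp(-sX), so the derivative is that of
Ad_{exp(sX)} Y, namely [X, Y]. -/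
theorem hasDerivAt_coAd (η : su2Dual) (X Y : su2) :
    HasDerivAt (fun s : ℝ => (coAd (expSU2 (-(s • X))) (.ofAdd η)).toAdd Y) (η ⁅X, Y⁆) 0 := by
  have e : (fun s : ℝ => (coAd (expSU2 (-(s • X))) (.ofAdd η)).toAdd Y)
      = fun s => η (Ad (expSU2 (-(s • X)))⁻¹ Y) := rfl
  rw [e]
  simp_rw [dual_eq_sum η (Ad _ _), coe_Ad_expSU2]
  rw [dual_eq_sum η ⁅X, Y⁆]
  have h01 := hasDerivAt_exp_conj X.1 Y.1 0 1
  have h00 := hasDerivAt_exp_conj X.1 Y.1 0 0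
  have r := (Complex.reCLM.hasFDerivAt.comp_hasDerivAt (0 : ℝ) h01).mul_const (η (su2Basis 0))
  have i := (Complex.imCLM.hasFDerivAt.comp_hasDerivAt (0 : ℝ) h01).mul_const (η (su2Basis 1))
  have j := (Complex.imCLM.hasFDerivAt.comp_hasDerivAt (0 : ℝ) h00).mul_const (η (su2Basis 2))
  exact (r.add i).add j

/-- The functional `Y ↦ η([X, Y])`. -/
def lieDual (η : su2Dual) (X : su2) : su2Dual where
  toFun Y := η ⁅X, Y⁆
  map_add' Y Z := by rw [lie_add, map_add]
  map_smul' c Y := by rw [lie_smul, map_smul]; rfl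

/-- The infinitesimal dressing action `-ξ + η ∘ ad_X` of `(X, ξ)` at `η`. -/
def dressingVelocity (η : su2Dual) : Double →ₗ[ℝ] su2Dual where
  toFun x := -x.2 + lieDual η x.1
  map_add' x y := by
    ext Y
    change -(x.2 Y + y.2 Y) + η ⁅x.1 + y.1, Y⁆ = (-x.2 Y + η ⁅x.1, Y⁆) + (-y.2 Y + η ⁅y.1, Y⁆)
    rw [add_lie, map_add]
    ring
  map_smul' c x := by
    ext Y
    change -(c * x.2 Y) + η ⁅c • x.1, Y⁆ = c * (-x.2 Y + η ⁅x.1, Y⁆)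
    rw [smul_lie, map_smul, smul_eq_mul]
    ring

theorem isDressingVelocity_iff (x : Double) (η ζ : su2Dual) :
    IsDressingVelocity x η ζ ↔ ζ = dressingVelocity η x := by
  have key : ∀ Y : su2, HasDerivAt (fun s : ℝ => dressing (doubleCurve x s) η Y)
      (dressingVelocity η x Y) 0 := by
    intro Y
    have h := (((hasDerivAt_id (0 : ℝ)).mul_const (x.2 Y)).neg).add (hasDerivAt_coAd η x.1 Y)
    rw [one_mul] at h
    exact h
  constructor
  · intro h
    ext Y
    exact (h Y).unique (key Y)
  · rintro rfl
    exact key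

/-- The twisted complement is parametrised by `ξ ↦ ξ + t(ξ)`. -/
def Twist.complementEquiv (t : Twist) : su2Dual ≃ₗ[ℝ] t.complement :=
  LinearEquiv.ofInjective (t.1.prod LinearMap.id) fun _ _ h => congrArg Prod.snd h

/-- The infinitesimal dressing action at `η` on the twisted complement. -/
def Twist.velocity (t : Twist) (η : su2Dual) : su2Dual →ₗ[ℝ] su2Dual :=
  dressingVelocity η ∘ₗ t.1.prod LinearMap.id

theorem Twist.velocity_apply (t : Twist) (η ξ : su2Dual) (Y : su2) :
    t.velocity η ξ Y = -ξ Y + η ⁅t.1 ξ, Y⁆ := rfl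

/-! ### Admissibility as a determinant condition -/

/-- The complement is a graph over su(2)*, so the action on it becomes an endomorphism of a
finite-dimensional space, for which injectivity is bijectivity. -/
theorem admissible_complement_iff (t : Twist) (η : su2Dual) :
    Admissible t.complement η ↔ Function.Injective (t.velocity η) := by
  constructor
  · rintro ⟨f, hf⟩
    have h : ⇑(t.velocity η) = f ∘ t.complementEquiv := by
      funext ξ
      exact ((isDressingVelocity_iff _ _ _).1 (hf (t.complementEquiv ξ))).symm
    rw [h]
    exact f.injective.comp t.complementEquiv.injective
  · intro h
    refine ⟨t.complementEquiv.symm.trans (LinearEquiv.ofInjectiveEndo _ h), fun x => ?_⟩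
    obtain ⟨ξ, rfl⟩ := t.complementEquiv.surjective x
    rw [isDressingVelocity_iff]
    simp only [LinearEquiv.trans_apply, LinearEquiv.symm_apply_apply]
    rfl

theorem velocity_dualBasis (t : Twist) (η : su2Dual) (i l : Fin 3) :
    t.velocity η (su2Basis.coord i) (su2Basis l) = -t.admissibilityMatrix η i l := by
  have h1 : t.1 (su2Basis.coord i) = ∑ j, t.component i j • su2Basis j :=
    (su2Basis.sum_repr _).symm
  have h2 : ∀ X : su2, η X = ∑ k, su2Basis.coord k X * η (su2Basis k) := fun X => by
    conv_lhs => rw [← su2Basis.sum_repr X]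
    simp only [map_sum, map_smul, smul_eq_mul, Module.Basis.coord_apply]
  -- The dressing action produces [e_j, e_l] whereas the matrix uses [e_l, e_j]; this swap supplies
  -- the overall minus sign.
  have h3 : ∀ j, η ⁅su2Basis j, su2Basis l⁆
      = -∑ k, su2Basis.coord k ⁅su2Basis l, su2Basis j⁆ * η (su2Basis k) := fun j => by
    rw [← lie_skew, map_neg, h2]
  rw [Twist.velocity_apply, h1, Twist.admissibilityMatrix, Matrix.of_apply]
  simp only [Fin.sum_univ_three, add_lie, smul_lie, map_add, map_smul, h3, smul_eq_mul]
  rw [Module.Basis.coord_apply, Module.Basis.repr_self, Finsupp.single_apply]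
  simp only [eq_comm (a := l)]
  ring

theorem velocity_injective_iff (t : Twist) (η : su2Dual) :
    Function.Injective (t.velocity η) ↔ (t.admissibilityMatrix η).det ≠ 0 := by
  have h : LinearMap.toMatrix su2Basis.dualBasis su2Basis.dualBasis (t.velocity η)
      = -(t.admissibilityMatrix η)ᵀ := by
    ext l i
    rw [LinearMap.toMatrix_apply, Module.Basis.dualBasis_repr, Module.Basis.coe_dualBasis,
      velocity_dualBasis]
    rfl
  rw [← LinearMap.ker_eq_bot, ← LinearMap.isUnit_iff_ker_eq_bot,
    LinearMap.isUnit_iff_isUnit_det, isUnit_iff_ne_zero,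
    ← LinearMap.det_toMatrix su2Basis.dualBasis, h, Matrix.det_neg, Matrix.det_transpose]
  simp

/-! ## The admissibility determinant -/

theorem su2Basis_lie_coord (i j k : Fin 3) :
    su2Basis.coord k ⁅su2Basis i, su2Basis j⁆
      = ![![![0, 0, 0], ![0, 0, 2], ![0, -2, 0]], ![![0, 0, -2], ![0, 0, 0], ![2, 0, 0]],
          ![![0, 2, 0], ![-2, 0, 0], ![0, 0, 0]]] i j k := by
  rw [su2Basis_coord, LieSubalgebra.coe_bracket, su2Basis_apply, su2Basis_apply, Ring.lie_def]
  fin_cases i <;> fin_cases j <;> fin_cases k <;> simp <;> norm_num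

theorem twistOf_component (a b c : ℝ) (i j : Fin 3) :
    (twistOf a b c).component i j = ![![0, a, b], ![-a, 0, c], ![-b, -c, 0]] i j := by
  have h : (twistOf a b c).1 (su2Basis.coord i)
      = a • (su2Basis.coord i (su2Basis 0) • su2Basis 1 - su2Basis.coord i (su2Basis 1) • su2Basis 0)
      + b • (su2Basis.coord i (su2Basis 0) • su2Basis 2 - su2Basis.coord i (su2Basis 2) • su2Basis 0)
      + c • (su2Basis.coord i (su2Basis 1) • su2Basis 2
        - su2Basis.coord i (su2Basis 2) • su2Basis 1) := rfl
  rw [Twist.component, h]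
  simp only [map_add, map_smul, map_sub, Module.Basis.coord_apply, Module.Basis.repr_self]
  fin_cases i <;> fin_cases j <;> simp

/-- The affine function `1 + 2 λ₂₃ ξ₁ - 2 λ₁₃ ξ₂ + 2 λ₁₂ ξ₃`. -/
def planeFun (a b c : ℝ) (ξ : su2Dual) : ℝ :=
  1 + 2 * c * ξ (su2Basis 0) - 2 * b * ξ (su2Basis 1) + 2 * a * ξ (su2Basis 2)

/-- Conceptually, with n = (c, -b, a), the twist acts as minus the cross product with n and the
structure constants give twice the cross product with ξ. Hence A = f·1 - 2 ξ nᵀ, with eigenvalues f,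
f and f - 2⟨n, ξ⟩ = 1. The code expands the 3 × 3 determinant directly. -/
theorem det_admissibilityMatrix (a b c : ℝ) (ξ : su2Dual) :
    ((twistOf a b c).admissibilityMatrix ξ).det = planeFun a b c ξ ^ 2 := by
  rw [Matrix.det_fin_three]
  simp only [Twist.admissibilityMatrix, Matrix.of_apply, su2Basis_lie_coord, twistOf_component,
    Fin.sum_univ_three]
  simp [planeFun]
  ring

theorem admissible_twistOf_iff (a b c : ℝ) (ξ : su2Dual) :
    Admissible (twistOf a b c).complement ξ ↔ planeFun a b c ξ ≠ 0 := by
  rw [admissible_complement_iff, velocity_injective_iff, det_admissibilityMatrix]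
  simp

/-! ## The sphere of radius one half -/

/-- The sphere of radius `1/2` in `su(2)*`. -/
def halfSphere : Set su2Dual :=
  {ξ | ξ (su2Basis 0) ^ 2 + ξ (su2Basis 1) ^ 2 + ξ (su2Basis 2) ^ 2 = (1 / 2) ^ 2}

/-- The element of `su(2)*` with given coordinates. -/
def dualOf (x y z : ℝ) : su2Dual :=
  x • su2Basis.coord 0 + y • su2Basis.coord 1 + z • su2Basis.coord 2

theorem dualOf_apply (x y z : ℝ) (i : Fin 3) : dualOf x y z (su2Basis i) = ![x, y, z] i := by
  simp only [dualOf, LinearMap.add_apply, LinearMap.smul_apply, Module.Basis.coord_apply,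
    Module.Basis.repr_self]
  fin_cases i <;> simp

theorem planeFun_pos {a b c : ℝ} (h : a ^ 2 + b ^ 2 + c ^ 2 < 1) {ξ : su2Dual}
    (hξ : ξ ∈ halfSphere) : 0 < planeFun a b c ξ := by
  simp only [halfSphere, Set.mem_ofPred_eq] at hξ
  simp only [planeFun]
  generalize ξ (su2Basis 0) = x at *
  generalize ξ (su2Basis 1) = y at *
  generalize ξ (su2Basis 2) = z at *
  -- With 4|ξ|² = 1, the three squares add up to |n|² - 1 + 2f, whence f ≥ (1 - |n|²)/2 > 0.
  nlinarith [sq_nonneg (c + 2 * x), sq_nonneg (b - 2 * y), sq_nonneg (a + 2 * z)]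

theorem exists_planeFun_eq_zero {a b c : ℝ} (h : 1 ≤ a ^ 2 + b ^ 2 + c ^ 2) :
    ∃ ξ ∈ halfSphere, planeFun a b c ξ = 0 := by
  -- A nonzero direction parallel to the plane f = 0, that is, orthogonal to its normal (c, -b, a).
  obtain ⟨u, v, w, horth, hne⟩ : ∃ u v w : ℝ, c * u - b * v + a * w = 0 ∧
      0 < u ^ 2 + v ^ 2 + w ^ 2 := by
    by_cases hbc : b ^ 2 + c ^ 2 = 0
    · have hb : b = 0 := by nlinarith [sq_nonneg b, sq_nonneg c]
      have hc : c = 0 := by nlinarith [sq_nonneg b, sq_nonneg c]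
      exact ⟨1, 0, 0, by simp [hb, hc], by norm_num⟩
    · exact ⟨b, c, 0, by ring, by positivity⟩
  set r := a ^ 2 + b ^ 2 + c ^ 2 with hr
  set n := u ^ 2 + v ^ 2 + w ^ 2 with hn
  have hr0 : 0 < r := by linarith
  -- The foot of the perpendicular from the origin to the plane has squared norm 1/(4r) ≤ 1/4; q is
  -- the displacement along (u, v, w) that brings the squared norm up to 1/4.
  set q := Real.sqrt ((1 / 4 - 1 / (4 * r)) / n) with hq
  have hq2 : q ^ 2 * n = 1 / 4 - 1 / (4 * r) := by
    rw [hq, Real.sq_sqrt, div_mul_cancel₀ _ hne.ne']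
    apply div_nonneg _ hne.le
    rw [sub_nonneg]
    gcongr
    linarith
  refine ⟨dualOf (-c / (2 * r) + q * u) (b / (2 * r) + q * v) (-a / (2 * r) + q * w), ?_, ?_⟩
  · simp only [halfSphere, Set.mem_ofPred_eq, dualOf_apply]
    have e : (-c / (2 * r) + q * u) ^ 2 + (b / (2 * r) + q * v) ^ 2 + (-a / (2 * r) + q * w) ^ 2
        = r / (2 * r) ^ 2 + q ^ 2 * n - q / r * (c * u - b * v + a * w) := by
      rw [hr, hn]
      rw [← hr]
      field_simp
      rw [hr]
      ring
    simp only [Matrix.cons_val_zero, Matrix.cons_val_one, Matrix.cons_val]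
    rw [e, hq2, horth]
    field_simp
    ring
  · simp only [planeFun, dualOf_apply, Matrix.cons_val_zero, Matrix.cons_val_one, Matrix.cons_val]
    have e : 1 + 2 * c * (-c / (2 * r) + q * u) - 2 * b * (b / (2 * r) + q * v)
        + 2 * a * (-a / (2 * r) + q * w)
        = 1 - (a ^ 2 + b ^ 2 + c ^ 2) / r + 2 * q * (c * u - b * v + a * w) := by
      field_simp
      ring
    rw [e, horth, ← hr, div_self hr0.ne']
    ring

/-! ## Affine charts and the Fubini–Study form -/

theorem affineChart_mem_atlas (i : Fin 2) : affineChart i ∈ atlas ℂ CP1 := ⟨i, rfl⟩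

theorem mdifferentiable_affineChart (i : Fin 2) :
    (affineChart i).MDifferentiable 𝓘(ℝ, ℂ) 𝓘(ℝ, ℂ) :=
  haveI : IsManifold 𝓘(ℝ, ℂ) 1 CP1 := IsManifold.of_le (n := ∞) (by simp)
  mdifferentiable_of_mem_atlas (affineChart_mem_atlas i)

theorem affineChart_symm_mem (i : Fin 2) (w : ℂ) : (affineChart i).symm w ∈ affineDomain i :=
  (affineChart i).map_target (Set.mem_univ w)

theorem affineChart_symm_apply (i : Fin 2) (w : ℂ) :
    affineChart i ((affineChart i).symm w) = w :=
  (affineChart i).right_inv (Set.mem_univ w)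

theorem affineChart_left_inv {i : Fin 2} {p : CP1} (hp : p ∈ affineDomain i) :
    (affineChart i).symm (affineChart i p) = p :=
  (affineChart i).left_inv hp

/-- The derivative of an affine chart, as an isomorphism. -/
def chartDeriv {i : Fin 2} {p : CP1} (hp : p ∈ affineDomain i) : TSpace ℂ p ≃L[ℝ] ℂ :=
  (mdifferentiable_affineChart i).mfderiv hp

theorem chartDeriv_apply {i : Fin 2} {p : CP1} (hp : p ∈ affineDomain i) (v : TSpace ℂ p) :
    chartDeriv hp v = mfderiv 𝓘(ℝ, ℂ) 𝓘(ℝ, ℂ) (affineChart i) p v := rfl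

theorem mfderiv_affineChart_symm (i : Fin 2) (w v : ℂ) :
    chartDeriv (affineChart_symm_mem i w)
      (mfderiv 𝓘(ℝ, ℂ) 𝓘(ℝ, ℂ) (affineChart i).symm w v) = v := by
  have h := (mdifferentiable_affineChart i).comp_symm_deriv (Set.mem_univ w)
  exact DFunLike.congr_fun h v

theorem area_cons (u v : ℂ) : area ![u, v] = u.re * v.im - v.re * u.im := by
  rw [area_apply]
  rfl

theorem twoForm_ext {V : Type*} [AddCommGroup V] [Module ℝ V] [TopologicalSpace V]
    {a b : V [⋀^Fin 2]→L[ℝ] ℝ} (h : ∀ u v, a ![u, v] = b ![u, v]) : a = b := by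
  ext x
  have hx : x = ![x 0, x 1] := by
    ext i
    fin_cases i <;> rfl
  rw [hx]
  exact h _ _

/-- The density `(x² + y² + 1)⁻²` of the Fubini–Study form. -/
def fubiniStudyDensity (w : ℂ) : ℝ := ((w.re ^ 2 + w.im ^ 2 + 1) ^ 2)⁻¹

theorem fubiniStudyDensity_pos (w : ℂ) : 0 < fubiniStudyDensity w := by
  unfold fubiniStudyDensity
  positivity

theorem fubiniStudyOn_apply {i : Fin 2} {p : CP1} (hp : p ∈ affineDomain i) (u v : TSpace ℂ p) :
    fubiniStudyOn i p ![u, v]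
      = fubiniStudyDensity (affineChart i p) * area ![chartDeriv hp u, chartDeriv hp v] := by
  have h : (⇑(mfderiv 𝓘(ℝ, ℂ) 𝓘(ℝ, ℂ) (affineChart i) p) ∘ ![u, v])
      = ![chartDeriv hp u, chartDeriv hp v] := by
    ext i
    fin_cases i <;> rfl
  exact congrArg (fubiniStudyModel (affineChart i p)) h

theorem affineCoord_succ {i : Fin 2} {p : CP1} (hp : p ∈ affineDomain i) :
    affineCoord (i + 1) p = (affineCoord i p)⁻¹ := by
  conv_lhs => rw [← affineChart_left_inv hp]
  exact affineChart_transition i _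

theorem affineCoord_ne_zero {i : Fin 2} {p : CP1} (hp : p ∈ affineDomain i)
    (hp' : p ∈ affineDomain (i + 1)) : affineCoord i p ≠ 0 := by
  obtain ⟨z, rfl⟩ := isQuotientMap_mk'.surjective p
  exact div_ne_zero ((mk_mem_affineDomain _ _).1 hp') ((mk_mem_affineDomain _ _).1 hp)

theorem chartDeriv_succ {i : Fin 2} {p : CP1} (hp : p ∈ affineDomain i)
    (hp' : p ∈ affineDomain (i + 1)) (v : TSpace ℂ p) :
    chartDeriv hp' v = -(chartDeriv hp v / affineChart i p ^ 2) := by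
  have hw : affineChart i p ≠ 0 := affineCoord_ne_zero hp hp'
  have h1 : HasMFDerivAt 𝓘(ℝ, ℂ) 𝓘(ℝ, ℂ) (affineChart i) p
      (mfderiv 𝓘(ℝ, ℂ) 𝓘(ℝ, ℂ) (affineChart i) p) :=
    ((mdifferentiable_affineChart i).mdifferentiableAt hp).hasMFDerivAt
  have h2 := ((hasDerivAt_inv hw).hasFDerivAt.restrictScalars ℝ).hasMFDerivAt
  have h3 := h2.comp p h1
  have h4 : affineChart (i + 1) =ᶠ[nhds p] (fun w : ℂ => w⁻¹) ∘ affineChart i :=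
    Filter.eventuallyEq_of_mem ((isOpen_affineDomain i).mem_nhds hp) fun q hq =>
      affineCoord_succ hq
  have h5 := (h3.congr_of_eventuallyEq h4).mfderiv
  rw [chartDeriv_apply, h5]
  change chartDeriv hp v • (-(affineChart i p ^ 2)⁻¹ : ℂ) = _
  rw [smul_eq_mul, mul_neg, div_eq_mul_inv]

theorem area_mul_mul (a u v : ℂ) : area ![a * u, a * v] = Complex.normSq a * area ![u, v] := by
  simp only [area_cons, Complex.mul_re, Complex.mul_im, Complex.normSq_apply]
  ring

/-- The transition w ↦ 1/w scales area by |w|⁻⁴, which cancels the change of density (1 + |w|⁻²)⁻² =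
|w|⁴ (1 + |w|²)⁻². -/
theorem fubiniStudyOn_succ {i : Fin 2} {p : CP1} (hp : p ∈ affineDomain i)
    (hp' : p ∈ affineDomain (i + 1)) : fubiniStudyOn (i + 1) p = fubiniStudyOn i p := by
  have hw : affineChart i p ≠ 0 := affineCoord_ne_zero hp hp'
  refine twoForm_ext fun u v => ?_
  have e : ∀ x : TSpace ℂ p, chartDeriv hp' x = -(affineChart i p ^ 2)⁻¹ * chartDeriv hp x :=
    fun x => by rw [chartDeriv_succ hp hp']; ring
  rw [fubiniStudyOn_apply hp, fubiniStudyOn_apply hp', e, e, area_mul_mul, ← mul_assoc]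
  congr 1
  have hc : affineChart (i + 1) p = (affineChart i p)⁻¹ := affineCoord_succ hp
  rw [hc]
  have hd : ∀ w : ℂ, fubiniStudyDensity w = ((Complex.normSq w + 1) ^ 2)⁻¹ := fun w => by
    rw [fubiniStudyDensity, Complex.normSq_apply]
    ring
  have hn : Complex.normSq (affineChart i p) ≠ 0 := by simpa using hw
  rw [hd, hd, Complex.normSq_neg, map_inv₀, map_inv₀, map_pow]
  have hn' := Complex.normSq_nonneg (affineChart i p)
  have h1 : Complex.normSq (affineChart i p) + 1 ≠ 0 := by positivity
  have h2 : (Complex.normSq (affineChart i p))⁻¹ + 1 ≠ 0 := by positivity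
  field_simp
  ring

theorem fubiniStudy_eq {i : Fin 2} {p : CP1} (hp : p ∈ affineDomain i) :
    fubiniStudy p = fubiniStudyOn i p := by
  unfold fubiniStudy
  have hj := (exists_mem_affineDomain p).choose_spec
  generalize (exists_mem_affineDomain p).choose = j at hj
  by_cases h : j = i
  · rw [h]
  · have h' : j = i + 1 := by fin_cases i <;> fin_cases j <;> simp_all
    subst h'
    exact fubiniStudyOn_succ hp hj

theorem fubiniStudy_apply {i : Fin 2} {p : CP1} (hp : p ∈ affineDomain i) (u v : TSpace ℂ p) :
    fubiniStudy p ![u, v]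
      = fubiniStudyDensity (affineChart i p) * area ![chartDeriv hp u, chartDeriv hp v] := by
  rw [fubiniStudy_eq hp, fubiniStudyOn_apply]

theorem contDiff_fubiniStudyDensity : ContDiff ℝ ∞ fubiniStudyDensity := by
  have hr : ContDiff ℝ ∞ Complex.re := Complex.reCLM.contDiff
  have hi : ContDiff ℝ ∞ Complex.im := Complex.imCLM.contDiff
  refine ContDiff.inv ?_ fun w => ?_
  · exact (((hr.pow 2).add (hi.pow 2)).add contDiff_const).pow 2
  · positivity

/-! ### Smoothness and derivatives read in the affine charts -/

theorem contMDiff_comp_affineChart_symm {f : CP1 → ℝ} (hf : ContMDiff 𝓘(ℝ, ℂ) 𝓘(ℝ, ℝ) ∞ f)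
    (i : Fin 2) : ContDiff ℝ ∞ (fun w => f ((affineChart i).symm w)) := by
  have h := contMDiffOn_symm_of_mem_maximalAtlas (I := 𝓘(ℝ, ℂ)) (n := ∞)
    (IsManifold.subset_maximalAtlas (affineChart_mem_atlas i))
  have h2 := hf.comp_contMDiffOn h
  exact (contMDiffOn_univ.1 h2).contDiff

theorem contMDiff_of_comp_affineChart_symm {f : CP1 → ℝ}
    (hf : ∀ i, ContDiff ℝ ∞ (fun w => f ((affineChart i).symm w))) :
    ContMDiff 𝓘(ℝ, ℂ) 𝓘(ℝ, ℝ) ∞ f := by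
  intro p
  obtain ⟨i, hp⟩ := exists_mem_affineDomain p
  have h := contMDiffOn_of_mem_maximalAtlas (I := 𝓘(ℝ, ℂ)) (n := ∞)
    (IsManifold.subset_maximalAtlas (affineChart_mem_atlas i))
  have h2 := ((hf i).contMDiff.comp_contMDiffOn h).contMDiffAt
    ((isOpen_affineDomain i).mem_nhds hp)
  refine h2.congr_of_eventuallyEq ?_
  refine Filter.eventuallyEq_of_mem ((isOpen_affineDomain i).mem_nhds hp) fun q hq => ?_
  exact congrArg f (affineChart_left_inv hq).symm

theorem mfderiv_eq_fderiv_chart {f : CP1 → ℝ} {i : Fin 2} {p : CP1} (hp : p ∈ affineDomain i)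
    (hf : DifferentiableAt ℝ (fun w => f ((affineChart i).symm w)) (affineChart i p))
    (v : TSpace ℂ p) :
    mfderiv 𝓘(ℝ, ℂ) 𝓘(ℝ, ℝ) f p v
      = fderiv ℝ (fun w => f ((affineChart i).symm w)) (affineChart i p) (chartDeriv hp v) := by
  have h1 : HasMFDerivAt 𝓘(ℝ, ℂ) 𝓘(ℝ, ℂ) (affineChart i) p
      (mfderiv 𝓘(ℝ, ℂ) 𝓘(ℝ, ℂ) (affineChart i) p) :=
    ((mdifferentiable_affineChart i).mdifferentiableAt hp).hasMFDerivAt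
  have h3 := hf.hasFDerivAt.hasMFDerivAt.comp p h1
  have h4 : f =ᶠ[nhds p] (fun w => f ((affineChart i).symm w)) ∘ affineChart i :=
    Filter.eventuallyEq_of_mem ((isOpen_affineDomain i).mem_nhds hp) fun q hq =>
      congrArg f (affineChart_left_inv hq).symm
  rw [(h3.congr_of_eventuallyEq h4).mfderiv]
  rfl

/-- The multiple of the Fubini–Study form by a function. -/
def scaledForm (g : CP1 → ℝ) : TwoForm ℂ CP1 := fun p => g p • fubiniStudy p

theorem scaledForm_apply (g : CP1 → ℝ) {i : Fin 2} {p : CP1} (hp : p ∈ affineDomain i)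
    (u v : TSpace ℂ p) :
    scaledForm g p ![u, v]
      = g p * fubiniStudyDensity (affineChart i p)
        * area ![chartDeriv hp u, chartDeriv hp v] := by
  rw [mul_assoc, ← fubiniStudy_apply hp]
  rfl

theorem scaledForm_inChart (g : CP1 → ℝ) (i : Fin 2) :
    (scaledForm g).inChart (affineChart i)
      = fun w => (g ((affineChart i).symm w) * fubiniStudyDensity w) • area := by
  funext w
  refine twoForm_ext fun u v => ?_
  have h : (⇑(mfderiv 𝓘(ℝ, ℂ) 𝓘(ℝ, ℂ) (affineChart i).symm w) ∘ ![u, v])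
      = ![mfderiv 𝓘(ℝ, ℂ) 𝓘(ℝ, ℂ) (affineChart i).symm w u,
        mfderiv 𝓘(ℝ, ℂ) 𝓘(ℝ, ℂ) (affineChart i).symm w v] := by
    ext i
    fin_cases i <;> rfl
  change scaledForm g ((affineChart i).symm w)
    (⇑(mfderiv 𝓘(ℝ, ℂ) 𝓘(ℝ, ℂ) (affineChart i).symm w) ∘ ![u, v]) = _
  rw [h, scaledForm_apply g (affineChart_symm_mem i w), mfderiv_affineChart_symm,
    mfderiv_affineChart_symm, affineChart_symm_apply]
  rfl

/-- Three vectors of a real plane are linearly dependent. This makes every two-form on the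
projective line closed. -/
theorem alternating_three_eq_zero (a : ℂ [⋀^Fin 3]→L[ℝ] ℝ) : a = 0 := by
  ext v
  apply a.toAlternatingMap.map_linearDependent
  intro h
  have := h.fintype_card_le_finrank
  simp [Complex.finrank_real_complex] at this

theorem area_nondegenerate {u : ℂ} (h : ∀ v, area ![u, v] = 0) : u = 0 := by
  have h1 := h Complex.I
  have h2 := h 1
  simp only [area_cons] at h1 h2
  apply Complex.ext <;> simp_all

theorem isSymplectic_scaledForm {g : CP1 → ℝ} (hg : ContMDiff 𝓘(ℝ, ℂ) 𝓘(ℝ, ℝ) ∞ g)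
    (h0 : ∀ p, g p ≠ 0) : IsSymplectic (scaledForm g) where
  smooth := by
    rintro _ ⟨i, rfl⟩
    rw [scaledForm_inChart]
    exact (((contMDiff_comp_affineChart_symm hg i).mul contDiff_fubiniStudyDensity).smul
      contDiff_const).contDiffOn
  closed := fun _ _ _ _ => alternating_three_eq_zero _
  nondegenerate := by
    intro p u h
    obtain ⟨i, hp⟩ := exists_mem_affineDomain p
    have h1 : chartDeriv hp u = 0 := area_nondegenerate fun v => by
      have h2 := h ((chartDeriv hp).symm v)
      rw [scaledForm_apply g hp, ContinuousLinearEquiv.apply_symm_apply] at h2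
      exact (mul_eq_zero.1 h2).resolve_left (mul_ne_zero (h0 p) (fubiniStudyDensity_pos _).ne')
    simpa using h1

theorem scaledForm_one : scaledForm (fun _ => 1) = fubiniStudy := by
  funext p
  exact one_smul ℝ _

theorem isSymplectic_fubiniStudy : IsSymplectic fubiniStudy := by
  rw [← scaledForm_one]
  exact isSymplectic_scaledForm contMDiff_const fun _ => one_ne_zero

/-! ## The fundamental vector fields -/

theorem hasDerivAt_expSU2_mulVec (X : su2) (z : Fin 2 → ℂ) (k : Fin 2) :
    HasDerivAt (fun s : ℝ => ((expSU2 (-(s • X))).1 *ᵥ z) k) (-(X.1 *ᵥ z) k) 0 := by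
  simp only [coe_expSU2_neg_smul, Matrix.mulVec, dotProduct, Fin.sum_univ_two]
  have h := ((hasDerivAt_exp_entry (-X.1) k 0).mul_const (z 0)).add
    ((hasDerivAt_exp_entry (-X.1) k 1).mul_const (z 1))
  refine h.congr_deriv ?_
  simp only [Matrix.neg_apply]
  ring

theorem expSU2_zero_mulVec (X : su2) (z : Fin 2 → ℂ) :
    (expSU2 (-((0 : ℝ) • X))).1 *ᵥ z = z := by
  rw [coe_expSU2_neg_smul, zero_smul, NormedSpace.exp_zero, Matrix.one_mulVec]

theorem expSU2_zero_smul (X : su2) : expSU2 (-((0 : ℝ) • X)) = 1 :=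
  Subtype.ext (by
    rw [coe_expSU2_neg_smul, zero_smul, NormedSpace.exp_zero]
    rfl)

/-- The velocity in the affine chart `i` of the infinitesimal action of a matrix. -/
def chartVelocity (i : Fin 2) (X : Matrix (Fin 2) (Fin 2) ℂ) (w : ℂ) : ℂ :=
  -(X *ᵥ affineVec i w) (i + 1) + w * (X *ᵥ affineVec i w) i

theorem hasDerivAt_affineCoord_exp (i : Fin 2) (X : su2) (w : ℂ) :
    HasDerivAt (fun s : ℝ => affineCoord i (expSU2 (-(s • X)) • (affineChart i).symm w))
      (chartVelocity i X.1 w) 0 := by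
  have h1 := hasDerivAt_expSU2_mulVec X (affineVec i w) (i + 1)
  have h2 := hasDerivAt_expSU2_mulVec X (affineVec i w) i
  have h0 : ((expSU2 (-((0 : ℝ) • X))).1 *ᵥ affineVec i w) i ≠ 0 := by
    rw [expSU2_zero_mulVec, affineVec_self]
    exact one_ne_zero
  refine (h1.div h2 h0).congr_deriv ?_
  rw [expSU2_zero_mulVec, affineVec_self, affineVec_other, chartVelocity]
  ring

/-- Lets a velocity obtained from the manifold chain rule be compared, by uniqueness, with one
computed by ordinary calculus. -/
theorem mfderiv_curve_eq {F : Type*} [NormedAddCommGroup F] [NormedSpace ℝ F] {f : ℝ → F} {s : ℝ}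
    {f' : TangentSpace 𝓘(ℝ, ℝ) s →L[ℝ] TangentSpace 𝓘(ℝ, F) (f s)} {v : F}
    (h : HasMFDerivAt 𝓘(ℝ, ℝ) 𝓘(ℝ, F) f s f') (hv : HasDerivAt f v s) : f' (1 : ℝ) = v := by
  let g : ℝ →L[ℝ] F := f'
  have h1 : HasFDerivAt f g s := hasMFDerivAt_iff_hasFDerivAt.1 h
  have h2 : g = ContinuousLinearMap.toSpanSingleton ℝ v := h1.unique hv.hasFDerivAt
  change g 1 = v
  rw [h2]
  exact one_smul ℝ v

/-- Differentiability of the orbit is proved alongside the formula, since `mfderiv` is zero by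
default at a point of non-differentiability. -/
theorem chartDeriv_fundamentalField (X : su2) {i : Fin 2} {p : CP1} (hp : p ∈ affineDomain i) :
    MDifferentiableAt 𝓘(ℝ, ℝ) 𝓘(ℝ, ℂ) (fun s : ℝ => expSU2 (-(s • X)) • p) 0 ∧
      chartDeriv hp (fundamentalField X p) = chartVelocity i X.1 (affineChart i p) := by
  have e0 : expSU2 (-((0 : ℝ) • X)) • p = p := by
    rw [expSU2_zero_smul, one_smul]
  have hk := hasDerivAt_affineCoord_exp i X (affineChart i p)
  rw [affineChart_left_inv hp] at hk
  -- The i-th homogeneous coordinate is 1 at s = 0, so by continuity the orbit stays in the chart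
  -- for small s.
  have hev : ∀ᶠ s : ℝ in nhds 0, expSU2 (-(s • X)) • p ∈ affineDomain i := by
    have h2 := (hasDerivAt_expSU2_mulVec X (affineVec i (affineChart i p)) i).continuousAt
    have h3 := h2.eventually_ne (y := 0) (by
      rw [expSU2_zero_mulVec, affineVec_self]
      exact one_ne_zero)
    filter_upwards [h3] with s hs
    rw [← affineChart_left_inv hp]
    exact (mk_mem_affineDomain i ⟨_, (smul_mk (expSU2 (-(s • X)))
      (affineVec i (affineChart i p)) (affineVec_ne_zero i _)).choose⟩).2 hs
  have hd : MDifferentiableAt 𝓘(ℝ, ℝ) 𝓘(ℝ, ℂ) (fun s : ℝ => expSU2 (-(s • X)) • p) 0 := by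
    have hs : MDifferentiableAt 𝓘(ℝ, ℂ) 𝓘(ℝ, ℂ) (affineChart i).symm
        ((fun s : ℝ => affineCoord i (expSU2 (-(s • X)) • p)) 0) :=
      (mdifferentiable_affineChart i).mdifferentiableAt_symm (Set.mem_univ _)
    refine (hs.comp (0 : ℝ) hk.differentiableAt.mdifferentiableAt).congr_of_eventuallyEq ?_
    filter_upwards [hev] with s hs
    exact (affineChart_left_inv hs).symm
  refine ⟨hd, ?_⟩
  have hp' : expSU2 (-((0 : ℝ) • X)) • p ∈ affineDomain i := by rwa [e0]
  have hc := ((mdifferentiable_affineChart i).mdifferentiableAt hp').hasMFDerivAt.comp (0 : ℝ)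
    hd.hasMFDerivAt
  refine Eq.trans ?_ (mfderiv_curve_eq hc hk)
  -- The chain rule is based at exp(-0·X) · p, which is identified with p only by rewriting with
  -- `e0`.
  change mfderiv 𝓘(ℝ, ℂ) 𝓘(ℝ, ℂ) (affineChart i) p _
    = mfderiv 𝓘(ℝ, ℂ) 𝓘(ℝ, ℂ) (affineChart i) (expSU2 (-((0 : ℝ) • X)) • p) _
  rw [e0]
  rfl

/-! ## The moment map -/

theorem momentMap_mk (z : Fin 2 → ℂ) (hz : z ≠ 0) (X : su2) :
    momentMap (Projectivization.mk ℂ z hz) X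
      = -(1 / 2) * ((z ⬝ᵥ star (X.1 *ᵥ z)) / (z ⬝ᵥ star z)).im := rfl

theorem star_mulVec_dotProduct (A : Matrix (Fin 2) (Fin 2) ℂ) (y z : Fin 2 → ℂ) :
    z ⬝ᵥ star (Aᴴ *ᵥ y) = (A *ᵥ z) ⬝ᵥ star y := by
  rw [Matrix.star_mulVec, Matrix.conjTranspose_conjTranspose, dotProduct_comm,
    ← Matrix.dotProduct_mulVec, dotProduct_comm]

/-- Unitarity moves g across the Hermitian product, in both numerator and denominator. -/
theorem momentMap_equivariant (g : SU2) (p : CP1) :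
    momentMap (g • p) = (coAd g (.ofAdd (momentMap p))).toAdd := by
  obtain ⟨⟨z, hz⟩, rfl⟩ := isQuotientMap_mk'.surjective p
  ext X
  obtain ⟨h, hg⟩ := smul_mk g z hz
  change momentMap (g • Projectivization.mk ℂ z hz) X
    = momentMap (Projectivization.mk ℂ z hz) (Ad g⁻¹ X)
  rw [hg, momentMap_mk, momentMap_mk]
  have hA : (Ad g⁻¹ X).1 = (g.1)ᴴ * X.1 * g.1 := by
    change (g⁻¹).1 * X.1 * (g⁻¹⁻¹).1 = _
    rw [inv_inv]
    rfl
  have hu : (g.1)ᴴ * g.1 = 1 := congrArg Subtype.val (inv_mul_cancel g)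
  have e1 : z ⬝ᵥ star ((Ad g⁻¹ X).1 *ᵥ z) = (g.1 *ᵥ z) ⬝ᵥ star (X.1 *ᵥ (g.1 *ᵥ z)) := by
    rw [hA, ← Matrix.mulVec_mulVec, ← Matrix.mulVec_mulVec, star_mulVec_dotProduct]
  have e2 : z ⬝ᵥ star z = (g.1 *ᵥ z) ⬝ᵥ star (g.1 *ᵥ z) := by
    rw [← star_mulVec_dotProduct, Matrix.mulVec_mulVec, hu, Matrix.one_mulVec]
  rw [e1, e2]

/-- The sign `1` or `-1` attached to an affine chart. -/
def chartSign (i : Fin 2) : ℝ := ![1, -1] i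

theorem su2_entries (X : su2) :
    X.1 1 0 = -(X.1 0 1).re + (X.1 0 1).im * Complex.I ∧ X.1 0 0 = (X.1 0 0).im * Complex.I ∧
      X.1 1 1 = -((X.1 0 0).im * Complex.I) := by
  obtain ⟨X, hX, hX'⟩ := X
  have h00 := congrFun (congrFun hX 0) 0
  have h01 := congrFun (congrFun hX 1) 0
  rw [Matrix.trace_fin_two] at hX'
  simp [Complex.ext_iff] at h00 h01 hX' ⊢
  grind

/-- Exchanging the homogeneous coordinates turns the coordinates (a, b, c) of X into (-a, b, -c);
`chartSign` records this, so one formula serves both charts. -/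
theorem momentMap_affineChart_symm (i : Fin 2) (w : ℂ) (X : su2) :
    momentMap ((affineChart i).symm w) X
      = (chartSign i * (X.1 0 0).im * (1 - w.re ^ 2 - w.im ^ 2) / 2
        + chartSign i * (X.1 0 1).re * w.im + (X.1 0 1).im * w.re)
          / (w.re ^ 2 + w.im ^ 2 + 1) := by
  change momentMap (Projectivization.mk ℂ (affineVec i w) (affineVec_ne_zero i w)) X = _
  rw [momentMap_mk]
  have hd : affineVec i w ⬝ᵥ star (affineVec i w) = ((w.re ^ 2 + w.im ^ 2 + 1 : ℝ) : ℂ) := by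
    fin_cases i <;>
      simp [affineVec, dotProduct, Fin.sum_univ_two, Complex.mul_conj, Complex.normSq_apply] <;> ring
  have h0 : w.re ^ 2 + w.im ^ 2 + 1 ≠ 0 := by positivity
  obtain ⟨h10, h00, h11⟩ := su2_entries X
  rw [hd, Complex.div_ofReal_im, mul_div_assoc']
  congr 1
  simp only [dotProduct, Matrix.mulVec, Fin.sum_univ_two, Pi.star_apply, h10, h11]
  rw [h00]
  fin_cases i <;> simp [affineVec, chartSign] <;> ring

theorem contDiff_momentMap_chart (i : Fin 2) (X : su2) :
    ContDiff ℝ ∞ (fun w => momentMap ((affineChart i).symm w) X) := by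
  have hr : ContDiff ℝ ∞ Complex.re := Complex.reCLM.contDiff
  have hi : ContDiff ℝ ∞ Complex.im := Complex.imCLM.contDiff
  simp_rw [momentMap_affineChart_symm]
  refine ContDiff.div ?_ ?_ fun w => by positivity
  · fun_prop
  · fun_prop

/-- This is the moment map identity in a chart, checked by restricting to the line w + sv, where the
one-variable quotient rule applies. -/
theorem fderiv_momentMap_chart (i : Fin 2) (X : su2) (w v : ℂ) :
    fderiv ℝ (fun w => momentMap ((affineChart i).symm w) X) w v
      = fubiniStudyDensity w * area ![chartVelocity i X.1 w, v] := by
  have hF := ((contDiff_momentMap_chart i X).differentiable (by simp) w).hasFDerivAt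
  have hF' : HasFDerivAt (fun w => momentMap ((affineChart i).symm w) X)
      (fderiv ℝ (fun w => momentMap ((affineChart i).symm w) X) w) (w + (0 : ℝ) • v) := by
    simpa using hF
  have hl : HasDerivAt (fun s : ℝ => w + s • v) v 0 := by
    simpa using ((hasDerivAt_id (0 : ℝ)).smul_const v).const_add w
  have h1 := hF'.comp_hasDerivAt (0 : ℝ) hl
  have hx : HasDerivAt (fun s : ℝ => w.re + s * v.re) v.re 0 := by
    simpa using ((hasDerivAt_id (0 : ℝ)).mul_const v.re).const_add w.re
  have hy : HasDerivAt (fun s : ℝ => w.im + s * v.im) v.im 0 := by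
    simpa using ((hasDerivAt_id (0 : ℝ)).mul_const v.im).const_add w.im
  set a := (X.1 0 1).re with ha
  set b := (X.1 0 1).im with hb
  set c := (X.1 0 0).im with hc
  have hn : HasDerivAt (fun s : ℝ =>
      chartSign i * c * (1 - (w.re + s * v.re) ^ 2 - (w.im + s * v.im) ^ 2) / 2
        + chartSign i * a * (w.im + s * v.im) + b * (w.re + s * v.re))
      (-(chartSign i * c * (w.re * v.re + w.im * v.im)) + chartSign i * a * v.im + b * v.re) 0 := by
    have h := (((((hx.pow 2).const_sub 1).sub (hy.pow 2)).const_mul (chartSign i * c)).div_const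
      2).add (hy.const_mul (chartSign i * a)) |>.add (hx.const_mul b)
    refine h.congr_deriv ?_
    norm_num
    ring
  have hdn : HasDerivAt (fun s : ℝ => (w.re + s * v.re) ^ 2 + (w.im + s * v.im) ^ 2 + 1)
      (2 * (w.re * v.re + w.im * v.im)) 0 := by
    refine (((hx.pow 2).add (hy.pow 2)).add_const (1 : ℝ)).congr_deriv ?_
    norm_num
    ring
  have h0 : (w.re + 0 * v.re) ^ 2 + (w.im + 0 * v.im) ^ 2 + 1 ≠ 0 := by positivity
  have h2 := hn.fun_div hdn h0
  have he : ((fun w => momentMap ((affineChart i).symm w) X) ∘ fun s : ℝ => w + s • v)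
      = fun s : ℝ => (chartSign i * c * (1 - (w.re + s * v.re) ^ 2 - (w.im + s * v.im) ^ 2) / 2
        + chartSign i * a * (w.im + s * v.im) + b * (w.re + s * v.re))
        / ((w.re + s * v.re) ^ 2 + (w.im + s * v.im) ^ 2 + 1) := by
    funext s
    simp only [Function.comp_apply, momentMap_affineChart_symm, Complex.add_re, Complex.add_im,
      Complex.smul_re, Complex.smul_im, smul_eq_mul, ha, hb, hc]
  rw [he] at h1
  rw [h1.unique h2]
  have hv : (chartVelocity i X.1 w).re = chartSign i * a * (1 + w.re ^ 2 - w.im ^ 2)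
        - 2 * chartSign i * c * w.im - 2 * b * w.re * w.im ∧
      (chartVelocity i X.1 w).im = -b + 2 * chartSign i * c * w.re
        + 2 * chartSign i * a * w.re * w.im + b * (w.re ^ 2 - w.im ^ 2) := by
    obtain ⟨h10, h00, h11⟩ := su2_entries X
    have h01 : X.1 0 1 = a + b * Complex.I := (Complex.re_add_im _).symm
    replace h00 : X.1 0 0 = c * Complex.I := h00
    replace h10 : X.1 1 0 = -a + b * Complex.I := h10
    replace h11 : X.1 1 1 = -(c * Complex.I) := h11
    clear_value a b c
    simp only [chartVelocity, Matrix.mulVec, dotProduct, Fin.sum_univ_two]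
    fin_cases i <;> simp [affineVec, chartSign, h00, h01, h10, h11] <;> constructor <;> ring
  rw [area_cons, hv.1, hv.2, fubiniStudyDensity]
  simp only [zero_mul, add_zero]
  rw [div_eq_inv_mul]
  congr 1
  ring

theorem momentMap_differential (X : su2) (p : CP1) (v : TSpace ℂ p) :
    mfderiv 𝓘(ℝ, ℂ) 𝓘(ℝ, ℝ) (fun q => momentMap q X) p v
      = fubiniStudy p ![fundamentalField X p, v] := by
  obtain ⟨i, hp⟩ := exists_mem_affineDomain p
  rw [fubiniStudy_apply hp, (chartDeriv_fundamentalField X hp).2, ← fderiv_momentMap_chart]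
  exact mfderiv_eq_fderiv_chart hp ((contDiff_momentMap_chart i X).differentiable (by simp) _) v

theorem contMDiff_momentMap (X : su2) :
    ContMDiff 𝓘(ℝ, ℂ) 𝓘(ℝ, ℝ) ∞ (fun p => momentMap p X) :=
  contMDiff_of_comp_affineChart_symm fun i => contDiff_momentMap_chart i X

theorem isMomentMap_momentMap : IsMomentMap fubiniStudy momentMap :=
  ⟨contMDiff_momentMap, momentMap_equivariant, momentMap_differential⟩

theorem su2Basis_entries (k : Fin 3) :
    ((su2Basis k).1 0 1).re = ![1, 0, 0] k ∧ ((su2Basis k).1 0 1).im = ![0, 1, 0] k ∧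
      ((su2Basis k).1 0 0).im = ![0, 0, 1] k := by
  rw [su2Basis_apply]
  fin_cases k <;> simp

theorem momentMap_affineChart_symm_basis (i : Fin 2) (w : ℂ) (k : Fin 3) :
    momentMap ((affineChart i).symm w) (su2Basis k)
      = ![chartSign i * w.im, w.re, chartSign i * (1 - w.re ^ 2 - w.im ^ 2) / 2] k
          / (w.re ^ 2 + w.im ^ 2 + 1) := by
  obtain ⟨h1, h2, h3⟩ := su2Basis_entries k
  rw [momentMap_affineChart_symm, h1, h2, h3]
  fin_cases k <;> simp

/-- In each chart the moment map is an inverse stereographic projection, up to the labelling of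
axes. -/
theorem range_momentMap : Set.range momentMap = halfSphere := by
  apply Set.Subset.antisymm
  · rintro _ ⟨p, rfl⟩
    obtain ⟨i, hp⟩ := exists_mem_affineDomain p
    rw [← affineChart_left_inv hp]
    generalize affineChart i p = w
    have h0 : w.re ^ 2 + w.im ^ 2 + 1 ≠ 0 := by positivity
    simp only [halfSphere, Set.mem_ofPred_eq, momentMap_affineChart_symm_basis]
    simp only [Matrix.cons_val_zero, Matrix.cons_val_one, Matrix.cons_val]
    field_simp
    fin_cases i <;> simp [chartSign] <;> ring
  · intro ξ hξ
    simp only [halfSphere, Set.mem_ofPred_eq] at hξ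
    have ext : ∀ p, (∀ k, momentMap p (su2Basis k) = ξ (su2Basis k)) →
        ξ ∈ Set.range momentMap := fun p h => ⟨p, su2Basis.ext h⟩
    -- The pole with ξ₃ = -1/2 is the only point missed by chart 0; it is the image of the origin of
    -- chart 1.
    by_cases hz : ξ (su2Basis 2) = -(1 / 2)
    · rw [hz] at hξ
      have hx : ξ (su2Basis 0) = 0 := by
        nlinarith [sq_nonneg (ξ (su2Basis 0)), sq_nonneg (ξ (su2Basis 1))]
      have hy : ξ (su2Basis 1) = 0 := by
        nlinarith [sq_nonneg (ξ (su2Basis 0)), sq_nonneg (ξ (su2Basis 1))]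
      refine ext ((affineChart 1).symm 0) fun k => ?_
      rw [momentMap_affineChart_symm_basis]
      fin_cases k
      · simp [hx]
      · simp [hy]
      · change _ = ξ (su2Basis 2)
        rw [hz]
        simp [chartSign]
        norm_num
    · obtain ⟨d, hd⟩ : ∃ d, ξ (su2Basis 2) = d - 1 / 2 := ⟨ξ (su2Basis 2) + 1 / 2, by ring⟩
      have hd0 : d ≠ 0 := fun h => hz (by rw [hd, h]; ring)
      rw [hd] at hξ
      have hr : (ξ (su2Basis 1) / d) ^ 2 + (ξ (su2Basis 0) / d) ^ 2 = 1 / d - 1 := by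
        field_simp
        linear_combination hξ
      -- In chart 0 one has d = ξ₃ + 1/2 = 1/(1 + |w|²), so stereographic projection gives w = (ξ₂ +
      -- iξ₁)/d.
      refine ext ((affineChart 0).symm ⟨ξ (su2Basis 1) / d, ξ (su2Basis 0) / d⟩) fun k => ?_
      rw [momentMap_affineChart_symm_basis]
      simp only [sub_sub, hr, chartSign, Matrix.cons_val_zero]
      fin_cases k
      · change 1 * (ξ (su2Basis 0) / d) / _ = ξ (su2Basis 0)
        field_simp
        ring
      · change ξ (su2Basis 1) / d / _ = ξ (su2Basis 1)
        field_simp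
        ring
      · change 1 * (1 - (1 / d - 1)) / 2 / _ = ξ (su2Basis 2)
        rw [hd]
        field_simp
        ring

/-! ## Two-forms and bivectors on a plane -/

/-- Alternating two-forms on a plane form a line, spanned by the determinant. -/
theorem exists_eq_mul_area {p : CP1} (a : TSpace ℂ p [⋀^Fin 2]→L[ℝ] ℝ)
    (L : TSpace ℂ p ≃L[ℝ] ℂ) : ∃ c : ℝ, ∀ u v, a ![u, v] = c * area ![L u, L v] := by
  let b : ℂ [⋀^Fin 2]→ₗ[ℝ] ℝ :=
    a.toAlternatingMap.compLinearMap (L.symm.toLinearEquiv : ℂ →ₗ[ℝ] TSpace ℂ p)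
  refine ⟨b Complex.basisOneI, fun u v => ?_⟩
  have h := AlternatingMap.congr_fun (b.eq_smul_basis_det Complex.basisOneI) ![L u, L v]
  refine Eq.trans ?_ h
  change a ![u, v] = a fun i => L.symm (![L u, L v] i)
  congr 1
  ext i
  fin_cases i
  · exact (L.symm_apply_apply u).symm
  · exact (L.symm_apply_apply v).symm

/-- The bivector `c x ∧ y`. -/
def planeBivector {V : Type*} [AddCommGroup V] [Module ℝ V] (c : ℝ) (x y : V) :
    LinearMap.BilinForm ℝ (Module.Dual ℝ V) :=
  c • (LinearMap.BilinForm.linMulLin (Module.Dual.eval ℝ V x) (Module.Dual.eval ℝ V y)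
    - LinearMap.BilinForm.linMulLin (Module.Dual.eval ℝ V y) (Module.Dual.eval ℝ V x))

theorem planeBivector_apply {V : Type*} [AddCommGroup V] [Module ℝ V] (c : ℝ) (x y : V)
    (α β : Module.Dual ℝ V) : planeBivector c x y α β = c * (α x * β y - α y * β x) := rfl

section Plane

variable {Ω : TwoForm ℂ CP1} {p : CP1} {L : TSpace ℂ p ≃L[ℝ] ℂ} {c : ℝ}

theorem flat_apply_symm (h : ∀ u v, Ω p ![u, v] = c * area ![L u, L v]) (u : TSpace ℂ p) (v : ℂ) :
    Ω.flat p u (L.symm v) = c * ((L u).re * v.im - v.re * (L u).im) := by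
  change Ω p ![u, L.symm v] = _
  rw [h, area_cons, ContinuousLinearEquiv.apply_symm_apply]

theorem dual_ext_plane {α β : Module.Dual ℝ (TSpace ℂ p)} (h1 : α (L.symm 1) = β (L.symm 1))
    (hI : α (L.symm Complex.I) = β (L.symm Complex.I)) : α = β := by
  have h : α ∘ₗ (L.symm.toLinearEquiv : ℂ →ₗ[ℝ] TSpace ℂ p)
      = β ∘ₗ (L.symm.toLinearEquiv : ℂ →ₗ[ℝ] TSpace ℂ p) := by
    refine Complex.basisOneI.ext fun i => ?_
    fin_cases i
    · simpa using h1
    · simpa using hI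
  ext v
  have hv := LinearMap.congr_fun h (L v)
  change α (L.symm (L v)) = β (L.symm (L v)) at hv
  rwa [ContinuousLinearEquiv.symm_apply_apply] at hv

theorem flat_surjective (h : ∀ u v, Ω p ![u, v] = c * area ![L u, L v]) (hc : c ≠ 0) :
    Function.Surjective (Ω.flat p) := by
  intro α
  -- The covector of u takes the values -c Im(Lu) at 1 and c Re(Lu) at i; the witness solves these
  -- two equations.
  refine ⟨L.symm ⟨c⁻¹ * α (L.symm Complex.I), -(c⁻¹ * α (L.symm 1))⟩, dual_ext_plane (L := L) ?_ ?_⟩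
  · rw [flat_apply_symm h, ContinuousLinearEquiv.apply_symm_apply]
    simp [hc]
  · rw [flat_apply_symm h, ContinuousLinearEquiv.apply_symm_apply]
    simp [hc]

theorem planeBivector_flat (h : ∀ u v, Ω p ![u, v] = c * area ![L u, L v]) (hc : c ≠ 0)
    (u v : TSpace ℂ p) :
    planeBivector c⁻¹ (L.symm 1) (L.symm Complex.I) (Ω.flat p u) (Ω.flat p v) = Ω p ![u, v] := by
  rw [planeBivector_apply, flat_apply_symm h, flat_apply_symm h, flat_apply_symm h,
    flat_apply_symm h, h, area_cons]
  simp only [Complex.one_re, Complex.one_im, Complex.I_re, Complex.I_im]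
  field_simp
  ring

/-- Since every covector is some Ω(u, ·), a nondegenerate form determines its bivector; this gives
all the uniqueness statements for bivectors below. -/
theorem bilin_ext_flat (h : ∀ u v, Ω p ![u, v] = c * area ![L u, L v]) (hc : c ≠ 0)
    {σ τ : LinearMap.BilinForm ℝ (Module.Dual ℝ (TSpace ℂ p))}
    (hστ : ∀ u v, σ (Ω.flat p u) (Ω.flat p v) = τ (Ω.flat p u) (Ω.flat p v)) : σ = τ := by
  ext α β
  obtain ⟨u, rfl⟩ := flat_surjective h hc α
  obtain ⟨v, rfl⟩ := flat_surjective h hc β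
  exact hστ u v

end Plane

/-! ## The bivector field of the Fubini–Study form -/

/-- The bivector field induced by the Fubini–Study form. -/
def stdBivector : BiField ℂ CP1 := fun p =>
  planeBivector (fubiniStudyDensity (affineChart (exists_mem_affineDomain p).choose p))⁻¹
    ((chartDeriv (exists_mem_affineDomain p).choose_spec).symm 1)
    ((chartDeriv (exists_mem_affineDomain p).choose_spec).symm Complex.I)

theorem corresponds_stdBivector : Corresponds fubiniStudy stdBivector := fun p u v =>
  planeBivector_flat (fubiniStudy_apply (exists_mem_affineDomain p).choose_spec)
    (fubiniStudyDensity_pos _).ne' u v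

theorem fubiniStudy_bilin_ext {p : CP1}
    {σ τ : LinearMap.BilinForm ℝ (Module.Dual ℝ (TSpace ℂ p))}
    (h : ∀ u v, σ (fubiniStudy.flat p u) (fubiniStudy.flat p v)
      = τ (fubiniStudy.flat p u) (fubiniStudy.flat p v)) : σ = τ :=
  bilin_ext_flat (fubiniStudy_apply (exists_mem_affineDomain p).choose_spec)
    (fubiniStudyDensity_pos _).ne' h

/-- Independence of the chart needs no change of coordinates: both sides are induced by the same
nondegenerate form. -/
theorem stdBivector_eq {i : Fin 2} {p : CP1} (hp : p ∈ affineDomain i) :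
    stdBivector p = planeBivector (fubiniStudyDensity (affineChart i p))⁻¹
      ((chartDeriv hp).symm 1) ((chartDeriv hp).symm Complex.I) := by
  refine fubiniStudy_bilin_ext fun u v => ?_
  rw [corresponds_stdBivector,
    planeBivector_flat (fubiniStudy_apply hp) (fubiniStudyDensity_pos _).ne']

theorem eq_stdBivector_of_corresponds {π : BiField ℂ CP1} (h : Corresponds fubiniStudy π) :
    π = stdBivector := by
  funext p
  refine fubiniStudy_bilin_ext fun u v => ?_
  rw [h, corresponds_stdBivector]

/-- The multiple of the bivector field of the Fubini–Study form by a function. -/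
def scaledBivector (f : CP1 → ℝ) : BiField ℂ CP1 := fun p => f p • stdBivector p

theorem scaledBivector_one : scaledBivector (fun _ => 1) = stdBivector := by
  funext p
  exact one_smul ℝ _

theorem scaledBivector_apply (f : CP1 → ℝ) {i : Fin 2} {p : CP1} (hp : p ∈ affineDomain i)
    (α β : Module.Dual ℝ (TSpace ℂ p)) :
    scaledBivector f p α β = f p * (fubiniStudyDensity (affineChart i p))⁻¹
      * (α ((chartDeriv hp).symm 1) * β ((chartDeriv hp).symm Complex.I)
        - α ((chartDeriv hp).symm Complex.I) * β ((chartDeriv hp).symm 1)) := by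
  rw [mul_assoc, ← planeBivector_apply, ← stdBivector_eq hp]
  rfl

theorem corresponds_scaledBivector {f : CP1 → ℝ} (h0 : ∀ p, f p ≠ 0) :
    Corresponds (scaledForm fun p => (f p)⁻¹) (scaledBivector f) := by
  intro p u v
  have hf : ∀ w, (scaledForm fun p => (f p)⁻¹).flat p w = (f p)⁻¹ • fubiniStudy.flat p w :=
    fun w => rfl
  have hs : (scaledForm fun p => (f p)⁻¹) p ![u, v] = (f p)⁻¹ * fubiniStudy p ![u, v] := rfl
  rw [hf, hf, hs, ← corresponds_stdBivector]
  simp only [map_smul, LinearMap.smul_apply, smul_eq_mul]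
  change (f p)⁻¹ * ((f p)⁻¹ * (f p * _)) = _
  rw [inv_mul_cancel_left₀ (h0 p)]

theorem scaledBivector_inChart (f : CP1 → ℝ) (i : Fin 2) (α β : Module.Dual ℝ ℂ) :
    (scaledBivector f).inChart (affineChart i) α β
      = fun w => f ((affineChart i).symm w) * (fubiniStudyDensity w)⁻¹
        * (α 1 * β Complex.I - α Complex.I * β 1) := by
  funext w
  have hp := affineChart_symm_mem i w
  have e : ∀ (γ : Module.Dual ℝ ℂ) (v : ℂ),
      (γ ∘ₗ (mfderiv 𝓘(ℝ, ℂ) 𝓘(ℝ, ℂ) (affineChart i) ((affineChart i).symm w)).toLinearMap)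
        ((chartDeriv hp).symm v) = γ v := fun γ v =>
    congrArg γ ((chartDeriv hp).apply_symm_apply v)
  unfold BiField.inChart
  rw [scaledBivector_apply f hp, e, e, e, e, affineChart_symm_apply]

theorem isNondegeneratePoisson_scaledBivector {f : CP1 → ℝ}
    (hf : ContMDiff 𝓘(ℝ, ℂ) 𝓘(ℝ, ℝ) ∞ f) (h0 : ∀ p, f p ≠ 0) :
    IsNondegeneratePoisson (scaledBivector f) where
  alternating := by
    intro p α
    obtain ⟨i, hp⟩ := exists_mem_affineDomain p
    rw [scaledBivector_apply f hp]
    ring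
  smooth := by
    rintro _ ⟨i, rfl⟩ α β
    rw [scaledBivector_inChart]
    exact (((contMDiff_comp_affineChart_symm hf i).mul (contDiff_fubiniStudyDensity.inv
      fun w => (fubiniStudyDensity_pos w).ne')).mul contDiff_const).contDiffOn
  schouten := by
    rintro _ ⟨i, rfl⟩ α β γ w -
    have hk : DifferentiableAt ℝ
        (fun w => f ((affineChart i).symm w) * (fubiniStudyDensity w)⁻¹) w :=
      ((contMDiff_comp_affineChart_symm hf i).mul (contDiff_fubiniStudyDensity.inv
        fun w => (fubiniStudyDensity_pos w).ne')).differentiable (by simp) w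
    have hd : ∀ (c : ℝ) (v : ℂ), fderiv ℝ
        (fun w => f ((affineChart i).symm w) * (fubiniStudyDensity w)⁻¹ * c) w v
        = c * fderiv ℝ (fun w => f ((affineChart i).symm w) * (fubiniStudyDensity w)⁻¹) w v :=
      fun c v => by rw [fderiv_mul_const hk]; rfl
    -- For a bivector k ∂_x ∧ ∂_y the cyclic sum is k times that of det(α, dk) det(β, γ), which
    -- vanishes by the Plücker relation for four covectors of a plane.
    simp only [BiField.halfSchouten, scaledBivector_inChart, ContinuousLinearMap.coe_coe, hd]
    ring
  nondegenerate := by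
    intro p α h
    obtain ⟨i, hp⟩ := exists_mem_affineDomain p
    have hc : f p * (fubiniStudyDensity (affineChart i p))⁻¹ ≠ 0 :=
      mul_ne_zero (h0 p) (inv_ne_zero (fubiniStudyDensity_pos _).ne')
    -- Pairing with dx and dy isolates the two components of α.
    have h1 := h (Complex.reLm ∘ₗ ((chartDeriv hp).toLinearEquiv : TSpace ℂ p →ₗ[ℝ] ℂ))
    have h2 := h (Complex.imLm ∘ₗ ((chartDeriv hp).toLinearEquiv : TSpace ℂ p →ₗ[ℝ] ℂ))
    rw [scaledBivector_apply f hp] at h1 h2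
    replace h1 := (mul_eq_zero.1 h1).resolve_left hc
    replace h2 := (mul_eq_zero.1 h2).resolve_left hc
    refine dual_ext_plane (L := chartDeriv hp) ?_ ?_
    · simpa using h2
    · simpa using h1

theorem eq_scaledForm_of_corresponds {f : CP1 → ℝ} {Ω : TwoForm ℂ CP1}
    (hΩ : IsSymplectic Ω) (h : Corresponds Ω (scaledBivector f)) :
    Ω = scaledForm fun p => (f p)⁻¹ := by
  funext p
  obtain ⟨i, hp⟩ := exists_mem_affineDomain p
  obtain ⟨c, hc⟩ := exists_eq_mul_area (Ω p) (chartDeriv hp)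
  -- Nondegeneracy is essential for uniqueness: the zero form corresponds to every bivector field.
  have hc0 : c ≠ 0 := by
    rintro rfl
    have h1 := hΩ.nondegenerate p ((chartDeriv hp).symm 1) fun v => by rw [hc, zero_mul]
    simp at h1
  have hσ : scaledBivector f p
      = planeBivector c⁻¹ ((chartDeriv hp).symm 1) ((chartDeriv hp).symm Complex.I) :=
    bilin_ext_flat hc hc0 fun u v => by rw [h, planeBivector_flat hc hc0]
  -- Evaluation on (dx, dy) reads off the coefficient: f divided by the density equals c⁻¹.
  have h1 := LinearMap.congr_fun₂ hσ
    (Complex.reLm ∘ₗ ((chartDeriv hp).toLinearEquiv : TSpace ℂ p →ₗ[ℝ] ℂ))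
    (Complex.imLm ∘ₗ ((chartDeriv hp).toLinearEquiv : TSpace ℂ p →ₗ[ℝ] ℂ))
  rw [scaledBivector_apply f hp, planeBivector_apply] at h1
  simp at h1
  refine twoForm_ext fun u v => ?_
  rw [hc, scaledForm_apply _ hp, ← inv_inv c, ← h1, mul_inv, inv_inv]

/-! ## The fundamental bivector field of a twist -/

/-- The left side is d⟨μ, X⟩(Y_M), the derivative of ⟨μ, X⟩ along the orbit of exp(-sY);
equivariance turns it into the derivative of the coadjoint action. -/
theorem fubiniStudy_fundamentalField (X Y : su2) (p : CP1) :
    fubiniStudy p ![fundamentalField X p, fundamentalField Y p] = momentMap p ⁅Y, X⁆ := by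
  obtain ⟨i, hp⟩ := exists_mem_affineDomain p
  have e0 : expSU2 (-((0 : ℝ) • Y)) • p = p := by
    rw [expSU2_zero_smul, one_smul]
  have hγ := (chartDeriv_fundamentalField Y hp).1.hasMFDerivAt
  have hμ := ((contMDiff_momentMap X).mdifferentiable (by simp)
    (expSU2 (-((0 : ℝ) • Y)) • p)).hasMFDerivAt
  have hk := hasDerivAt_coAd (momentMap p) Y X
  simp_rw [← momentMap_equivariant] at hk
  rw [← momentMap_differential]
  have hc := hμ.comp (0 : ℝ) hγ
  refine Eq.trans ?_ (mfderiv_curve_eq hc hk)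
  change mfderiv 𝓘(ℝ, ℂ) 𝓘(ℝ, ℝ) (fun q => momentMap q X) p _
    = mfderiv 𝓘(ℝ, ℂ) 𝓘(ℝ, ℝ) (fun q => momentMap q X) (expSU2 (-((0 : ℝ) • Y)) • p) _
  rw [e0]
  rfl

theorem fubiniStudy_plucker (p : CP1) (u v x y : TSpace ℂ p) :
    fubiniStudy p ![u, x] * fubiniStudy p ![v, y] - fubiniStudy p ![u, y] * fubiniStudy p ![v, x]
      = fubiniStudy p ![u, v] * fubiniStudy p ![x, y] := by
  obtain ⟨i, hp⟩ := exists_mem_affineDomain p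
  simp only [fubiniStudy_apply hp, area_cons]
  ring

theorem dual_lie_basis (η : su2Dual) (i j : Fin 3) :
    η ⁅su2Basis i, su2Basis j⁆
      = ![![0, 2 * η (su2Basis 2), -2 * η (su2Basis 1)],
          ![-2 * η (su2Basis 2), 0, 2 * η (su2Basis 0)],
          ![2 * η (su2Basis 1), -2 * η (su2Basis 0), 0]] i j := by
  have h : ∀ X : su2, η X = su2Basis.coord 0 X * η (su2Basis 0)
      + su2Basis.coord 1 X * η (su2Basis 1) + su2Basis.coord 2 X * η (su2Basis 2) := dual_eq_sum η
  rw [h]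
  simp only [su2Basis_lie_coord]
  fin_cases i <;> fin_cases j <;> simp

/-- On the covectors Ω(u, ·) and Ω(v, ·), each pair i < j contributes to t_M a 2 × 2 minor, equal by
the Plücker relation to Ω(u, v) Ω(X_i, X_j) = Ω(u, v) ⟨μ, [e_j, e_i]⟩. The total is (1 - f ∘ μ) Ω(u,
v). -/
theorem stdBivector_sub_fundamentalBivector (a b c : ℝ) :
    stdBivector - (twistOf a b c).fundamentalBivector
      = scaledBivector fun p => planeFun a b c (momentMap p) := by
  funext p
  refine fubiniStudy_bilin_ext fun u v => ?_
  set X : Fin 3 → TSpace ℂ p := fun i => fundamentalField (su2Basis i) p with hX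
  have ht : (twistOf a b c).fundamentalBivector p (fubiniStudy.flat p u) (fubiniStudy.flat p v)
      = ∑ i, ∑ j, (twistOf a b c).component i j
        * (fubiniStudy p ![u, X i] * fubiniStudy p ![v, X j]) := by
    simp only [Twist.fundamentalBivector, LinearMap.sum_apply, LinearMap.smul_apply, smul_eq_mul]
    rfl
  have hl : (stdBivector - (twistOf a b c).fundamentalBivector) p (fubiniStudy.flat p u)
      (fubiniStudy.flat p v) = fubiniStudy p ![u, v]
        - (twistOf a b c).fundamentalBivector p (fubiniStudy.flat p u) (fubiniStudy.flat p v) := by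
    rw [← corresponds_stdBivector]
    rfl
  have hr : scaledBivector (fun p => planeFun a b c (momentMap p)) p (fubiniStudy.flat p u)
      (fubiniStudy.flat p v) = planeFun a b c (momentMap p) * fubiniStudy p ![u, v] := by
    rw [← corresponds_stdBivector]
    rfl
  have h01 := fubiniStudy_plucker p u v (X 0) (X 1)
  have h02 := fubiniStudy_plucker p u v (X 0) (X 2)
  have h12 := fubiniStudy_plucker p u v (X 1) (X 2)
  simp only [hX, fubiniStudy_fundamentalField, dual_lie_basis] at h01 h02 h12
  rw [hl, hr, ht]
  simp only [Fin.sum_univ_three, twistOf_component, planeFun, hX]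
  simp at h01 h02 h12 ⊢
  linear_combination -a * h01 - b * h02 - c * h12

/-! ### Existence and uniqueness of the deformed form -/

theorem contMDiff_planeFun (a b c : ℝ) :
    ContMDiff 𝓘(ℝ, ℂ) 𝓘(ℝ, ℝ) ∞ (fun p => planeFun a b c (momentMap p)) := by
  refine contMDiff_of_comp_affineChart_symm fun i => ?_
  have h := fun k => contDiff_momentMap_chart i (su2Basis k)
  exact ((contDiff_const.add (contDiff_const.mul (h 0))).sub (contDiff_const.mul (h 1))).add
    (contDiff_const.mul (h 2))

theorem existsUnique_deforms {a b c : ℝ} (h0 : ∀ p, planeFun a b c (momentMap p) ≠ 0) :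
    ∃! Ω : TwoForm ℂ CP1, Deforms (twistOf a b c) fubiniStudy Ω := by
  have hstd : IsNondegeneratePoisson stdBivector := by
    rw [← scaledBivector_one]
    exact isNondegeneratePoisson_scaledBivector contMDiff_const fun _ => one_ne_zero
  have hinv : ContMDiff 𝓘(ℝ, ℂ) 𝓘(ℝ, ℝ) ∞ (fun p => (planeFun a b c (momentMap p))⁻¹) :=
    contMDiff_of_comp_affineChart_symm fun i =>
      (contMDiff_comp_affineChart_symm (contMDiff_planeFun a b c) i).inv fun _ => h0 _
  refine ⟨scaledForm fun p => (planeFun a b c (momentMap p))⁻¹, ⟨isSymplectic_fubiniStudy,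
    isSymplectic_scaledForm hinv fun p => inv_ne_zero (h0 p), stdBivector, hstd,
    corresponds_stdBivector, ?_, ?_⟩, ?_⟩
  · rw [stdBivector_sub_fundamentalBivector]
    exact isNondegeneratePoisson_scaledBivector (contMDiff_planeFun a b c) h0
  · rw [stdBivector_sub_fundamentalBivector]
    exact corresponds_scaledBivector h0
  -- The bivector π is existentially quantified, so it is first identified with `stdBivector`; only
  -- then does (f ∘ μ) π determine Ω.
  · rintro Ω ⟨-, hΩ, π, -, hπ, -, h⟩
    rw [eq_stdBivector_of_corresponds hπ, stdBivector_sub_fundamentalBivector] at h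
    exact eq_scaledForm_of_corresponds hΩ h

theorem planeFun_momentMap_pos {a b c : ℝ} (h : a ^ 2 + b ^ 2 + c ^ 2 < 1) (p : CP1) :
    0 < planeFun a b c (momentMap p) :=
  planeFun_pos h (range_momentMap ▸ Set.mem_range_self p)

theorem forall_admissible_iff (a b c : ℝ) :
    (∀ p, Admissible (twistOf a b c).complement (momentMap p)) ↔
      a ^ 2 + b ^ 2 + c ^ 2 < 1 := by
  simp only [admissible_twistOf_iff]
  refine ⟨fun h => ?_, fun h p => (planeFun_momentMap_pos h p).ne'⟩
  by_contra! h1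
  obtain ⟨ξ, hξ, h2⟩ := exists_planeFun_eq_zero h1
  rw [← range_momentMap] at hξ
  obtain ⟨p, rfl⟩ := hξ
  exact h p h2

end TwistDeformation

end

open TwistDeformation in
theorem mainTheorem3 :
    -- the Fubini–Study form and the moment map
    IsSymplectic fubiniStudy ∧
    (∀ i, ∀ p ∈ (affineChart i).source, fubiniStudy p = fubiniStudyOn i p) ∧
    IsMomentMap fubiniStudy momentMap ∧
    Set.range momentMap = {ξ : su2Dual |
      ξ (su2Basis 0) ^ 2 + ξ (su2Basis 1) ^ 2 + ξ (su2Basis 2) ^ 2 = (1 / 2) ^ 2} ∧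
    ∀ l12 l13 l23 : ℝ,
      -- the admissibility determinant of the twist with components `t^{ij} = l_ij`
      (∀ ξ : su2Dual,
        ((twistOf l12 l13 l23).admissibilityMatrix ξ).det =
          (1 + 2 * l23 * ξ (su2Basis 0) - 2 * l13 * ξ (su2Basis 1) + 2 * l12 * ξ (su2Basis 2)) ^ 2 ∧
        (Admissible (twistOf l12 l13 l23).complement ξ ↔
          1 + 2 * l23 * ξ (su2Basis 0) - 2 * l13 * ξ (su2Basis 1) + 2 * l12 * ξ (su2Basis 2) ≠ 0)) ∧
      ((∀ p, Admissible (twistOf l12 l13 l23).complement (momentMap p)) ↔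
        l12 ^ 2 + l13 ^ 2 + l23 ^ 2 < 1) ∧
      (l12 ^ 2 + l13 ^ 2 + l23 ^ 2 < 1 →
        Disjoint {ξ : su2Dual |
            1 + 2 * l23 * ξ (su2Basis 0) - 2 * l13 * ξ (su2Basis 1) + 2 * l12 * ξ (su2Basis 2) = 0}
          (Set.range momentMap) ∧
        -- the twist with components `t^{ij} = l_ij`, and the twist `∑_{i<j} ½ l_ij e_i ∧ e_j`
        ∀ t : Twist, t = twistOf l12 l13 l23 ∨ t = twistOf (l12 / 2) (l13 / 2) (l23 / 2) →
          (∀ p, Admissible t.complement (momentMap p)) ∧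
          ∃! Ω : TwoForm ℂ CP1, Deforms t fubiniStudy Ω) := by
  refine ⟨isSymplectic_fubiniStudy, fun i p hp => fubiniStudy_eq hp, isMomentMap_momentMap,
    range_momentMap, fun l12 l13 l23 => ⟨fun ξ => ⟨det_admissibilityMatrix l12 l13 l23 ξ,
      admissible_twistOf_iff l12 l13 l23 ξ⟩, forall_admissible_iff l12 l13 l23, fun h => ⟨?_, ?_⟩⟩⟩
  · rw [range_momentMap, Set.disjoint_left]
    exact fun ξ hξ hξ' => (planeFun_pos h hξ').ne' hξ
  · have key : ∀ a b c : ℝ, a ^ 2 + b ^ 2 + c ^ 2 < 1 →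
        (∀ p, Admissible (twistOf a b c).complement (momentMap p)) ∧
          ∃! Ω : TwoForm ℂ CP1, Deforms (twistOf a b c) fubiniStudy Ω := fun a b c habc =>
      ⟨(forall_admissible_iff a b c).2 habc,
        existsUnique_deforms fun p => (planeFun_momentMap_pos habc p).ne'⟩
    rintro t (rfl | rfl)
    · exact key _ _ _ h
    · refine key _ _ _ ?_
      -- Halving the twist divides the sum of squares by four, so it remains below 1.
      nlinarith [sq_nonneg l12, sq_nonneg l13, sq_nonneg l23]
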